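/- A sequence below is a sequence $(M_j)_{j\ge 0}$ of positive reals. Write $\check M_j=M_j/j!$ and $\overline{\mathbb G}^{s}=(j^{js})_{j\ge0}$ with $0^0=1$, with products of sequences taken termwise. A sequence is (lc) if $M_j^2\le M_{j-1}M_{j+1}$ for all $j\ge 1$. Write $\mathbb M\preceq\mathbb L$ if there are $A,B>0$ with $M_j\le AB^jL_j$ for all $j$; $\mathbb M$ and $\mathbb L$ are equivalent if $\mathbb M\preceq\mathbb L\preceq\mathbb M$. The log-convex minorant $\mathbb N^{\mathrm{lc}}$ is the largest (lc) sequence $\le\mathbb N$. A weight matrix is a family $\mathcal M=\{\mathbb M^{(p)}:p>0\}$ of sequences with $M^{(p)}_0=1$ and $\mathbb M^{(p)}\le\mathbb M^{(q)}$ for $p\le q$. Consider the conditions - $(\mathcal M_{\{C^\omega\}})$: there is $p>0$ with $\liminf_{j\to\infty}(\check M^{(p)}_j)^{1/j}>0$ (the value $+\infty$ being allowed); - $(\mathcal M_{\{\mathrm{rai}\}})$: for all $p>0$ there are $C>0$, $q>0$ with $(\check M^{(p)}_j)^{1/j}\le C(\check M^{(q)}_k)^{1/k}$ for all $1\le j\le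 k$; - $(\mathcal M_{\{\mathrm{dc}\}})$: for all $p>0$ there are $C>0$, $q>0$ with $M^{(p)}_{j+1}\le C^{j+1}M^{(q)}_j$ for all $j\ge0$; - $(\mathcal M_{\{\mathrm{FdB}\}})$: for all $p>0$ there is $q>0$ with $(\check{\mathbb M}^{(p)})^\circ\preceq\check{\mathbb M}^{(q)}$, where $N^\circ_0=1$ and $N^\circ_k=\max\{N_\ell N_{j_1}\cdots N_{j_\ell}:\ \ell\ge 1,\ j_i\ge1,\ j_1+\dots+j_\ell=k\}$ for $k\ge1$. For $\alpha>0$ let $S_\alpha=\{z:|\arg z|<\alpha\pi/2\}$, a sector in the Riemann surface of the logarithm. Let $\mathcal A_{\{\mathcal M\}}(S_\alpha)$ be the set of holomorphic $f:S_\alpha\to\mathbb C$ for which there are $p,h>0$ with $\sup_{z\in S_\alpha,\,j\ge0}|f^{(j)}(z)|/(h^jM^{(p)}_j)<\infty$. For $U\subseteq\mathbb C$ open, let $\mathcal H_{\{\mathcal M\}}(U)$ be the set of holomorphic $g:U\to\mathbb C$ such that for every compact $K\subset U$ there are $p,h>0$ with $\sup_{z\in K,\,j\ge0}|g^{(j)}(z)|/(h^jM^{(p)}_j)<\infty$.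 The class $\mathcal A_{\{\mathcal M\}}(S_\alpha)$ is *holomorphically closed* (resp. *closed under composition*) if $g\circ f\in\mathcal A_{\{\mathcal M\}}(S_\alpha)$ whenever $f\in\mathcal A_{\{\mathcal M\}}(S_\alpha)$, $U\subseteq\mathbb C$ is an open set containing the closure of the range of $f$, and $g$ is holomorphic on $U$ (resp. $g\in\mathcal H_{\{\mathcal M\}}(U)$). It is *inverse-closed* if $1/f\in\mathcal A_{\{\mathcal M\}}(S_\alpha)$ whenever $f\in\mathcal A_{\{\mathcal M\}}(S_\alpha)$ and $\inf_{S_\alpha}|f|>0$. **Corollary.** Let $\mathcal M=\{\mathbb M^{(p)}:p>0\}$ be a weight matrix and $\alpha>1$. Suppose that for each $p>0$ there is some $\alpha_p>\alpha$ such that $\overline{\mathbb G}^{1-\alpha_p}\mathbb M^{(p)}$ is equivalent to an (lc) sequence $\mathbb L^{(p)}$, and that there is $\beta>\alpha$ with $\beta<\alpha_p$ for all $p>0$. Then $\lim_{j\to\infty}(j^{(1-\beta)j}M^{(p)}_j)^{1/j}=\infty$ for all $p>0$, so that the matrix $\mathcal M^\beta=\{\overline{\mathbb G}^{\beta-1}(\overline{\mathbb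 G}^{1-\beta}\mathbb M^{(p)})^{\mathrm{lc}}:p>0\}$ is defined, and the following are equivalent: - (a) $\mathcal M$ satisfies $(\mathcal M_{\{\mathrm{rai}\}})$; - (a') $\mathcal M^\beta$ satisfies $(\mathcal M_{\{\mathrm{rai}\}})$; - (b) $\mathcal A_{\{\mathcal M\}}(S_\alpha)$ is holomorphically closed; - (c) $\mathcal A_{\{\mathcal M\}}(S_\alpha)$ is inverse-closed. Moreover, the following two assertions are equivalent to each other: - (e) $\mathcal M$ satisfies $(\mathcal M_{\{\mathrm{FdB}\}})$; - (e') $\mathcal M^\beta$ satisfies $(\mathcal M_{\{\mathrm{FdB}\}})$. If in addition $\mathcal M$ has $(\mathcal M_{\{C^\omega\}})$ and $(\mathcal M_{\{\mathrm{dc}\}})$, then (a), (a'), (b), (c), (e), (e') are all equivalent, and also equivalent to - (d) $\mathcal A_{\{\mathcal M\}}(S_\alpha)$ is closed under composition. -/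

import Mathlib

/-! Ultraholomorphic classes of Roumieu type defined by weight matrices, on unbounded sectors of
the Riemann surface of the logarithm. -/

namespace Ultraholo

/-! ### Sequences of positive real numbers -/

/-- The sequence `j ↦ j ^ (j * s)`, with `0 ^ 0 = 1`. -/
noncomputable def gevreyBar (s : ℝ) (j : ℕ) : ℝ := (j : ℝ) ^ ((j : ℝ) * s)

/-- `j ↦ M j / j!`. -/
noncomputable def check (M : ℕ → ℝ) (j : ℕ) : ℝ := M j / (j.factorial : ℝ)

/-- A log-convex sequence of positive real numbers. -/
def IsLogConvex (L : ℕ → ℝ) : Prop :=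
  (∀ j, 0 < L j) ∧ ∀ j, L (j + 1) ^ 2 ≤ L j * L (j + 2)

/-- `M ≼ L`: there are `A, B > 0` with `M j ≤ A * B ^ j * L j` for all `j`. -/
def SeqLE (M L : ℕ → ℝ) : Prop :=
  ∃ A > 0, ∃ B > 0, ∀ j, M j ≤ A * B ^ j * L j

/-- Equivalence of sequences, `M ≈ L`. -/
def SeqEquiv (M L : ℕ → ℝ) : Prop := SeqLE M L ∧ SeqLE L M

/-- The log-convex minorant of `N`: the pointwise supremum of all (positive) log-convex sequences
below `N`. It is the largest such sequence as soon as there is one. -/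
noncomputable def lcMinorant (N : ℕ → ℝ) (j : ℕ) : ℝ :=
  sSup {x | ∃ L : ℕ → ℝ, IsLogConvex L ∧ (∀ i, L i ≤ N i) ∧ x = L j}

/-- The sequence `N°`: `N° 0 = 1`, and for `k ≥ 1`, `N° k` is the maximum of
`N ℓ * N j₁ * ⋯ * N j_ℓ` over all `j₁, …, j_ℓ ≥ 1` with `j₁ + ⋯ + j_ℓ = k`
(that is, over all compositions of `k`). -/
noncomputable def circ (N : ℕ → ℝ) (k : ℕ) : ℝ :=
  if k = 0 then 1
  else (Finset.univ : Finset (Composition k)).sup' Finset.univ_nonempty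
    (fun c => N c.length * ∏ i : Fin c.length, N (c.blocksFun i))

/-! ### Weight matrices -/

/-- The index set `ℝ_{>0}`. -/
abbrev Idx : Type := Set.Ioi (0 : ℝ)

/-- `M` is a weight matrix: a nondecreasing family of positive sequences with `M p 0 = 1`. -/
structure IsWeightMatrix (M : Idx → ℕ → ℝ) : Prop where
  pos : ∀ p j, 0 < M p j
  zero : ∀ p, M p 0 = 1
  mono : ∀ p q, p ≤ q → ∀ j, M p j ≤ M q j

/-- The Roumieu-type condition `(M_{C^ω})`. The lower limit is taken in `[0, ∞]`. -/
def CondComega (M : Idx → ℕ → ℝ) : Prop :=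
  ∃ p, 0 < Filter.liminf
    (fun j : ℕ => ENNReal.ofReal (check (M p) j ^ (1 / (j : ℝ)))) Filter.atTop

/-- The root almost increasing property `(M_{rai})`. -/
def CondRai (M : Idx → ℕ → ℝ) : Prop :=
  ∀ p, ∃ C > 0, ∃ q, ∀ j k : ℕ, 1 ≤ j → j ≤ k →
    check (M p) j ^ (1 / (j : ℝ)) ≤ C * check (M q) k ^ (1 / (k : ℝ))

/-- The Faà di Bruno property `(M_{FdB})`. -/
def CondFdB (M : Idx → ℕ → ℝ) : Prop :=
  ∀ p, ∃ q, SeqLE (circ (check (M p))) (check (M q))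

/-- Derivation closedness `(M_{dc})`. -/
def CondDc (M : Idx → ℕ → ℝ) : Prop :=
  ∀ p, ∃ C > 0, ∃ q, ∀ j, M p (j + 1) ≤ C ^ (j + 1) * M q j

/-- The matrix `M^b`, with rows `j ↦ j ^ (j (b - 1)) * (i ↦ i ^ (i (1 - b)) * M p i)^lc j`. -/
noncomputable def rami (M : Idx → ℕ → ℝ) (b : ℝ) (p : Idx) (j : ℕ) : ℝ :=
  gevreyBar (b - 1) j * lcMinorant (fun i => gevreyBar (1 - b) i * M p i) j

/-! ### The Riemann surface of the logarithm -/

/-- The Riemann surface of the logarithm, in its global coordinate `log`: the complex number `z`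
stands for the point with modulus `exp z.re` and argument `z.im ∈ ℝ`, lying over
`Complex.exp z ∈ ℂ \ {0}`. -/
abbrev LogSurface : Type := ℂ

/-- The unbounded sector of opening `α π` bisected by direction `0`: the points whose argument has
absolute value less than `α π / 2`. -/
def sector (α : ℝ) : Set LogSurface := {z | |z.im| < α * Real.pi / 2}

/-- The complex derivative of a function on the surface, with respect to the local coordinate
`Complex.exp` given by the projection to `ℂ \ {0}`
(see `surfaceDeriv_comp_exp`), and not with respect to `log`. -/
noncomputable def surfaceDeriv (f : LogSurface → ℂ) (z : LogSurface) : ℂ :=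
  Complex.exp (-z) * deriv f z

/-- On functions that come from the plane, `surfaceDeriv` is the ordinary derivative. -/
theorem surfaceDeriv_comp_exp (g : ℂ → ℂ) (z : LogSurface)
    (hg : DifferentiableAt ℂ g (Complex.exp z)) :
    surfaceDeriv (fun w => g (Complex.exp w)) z = deriv g (Complex.exp z) := by
  have h := (hg.hasDerivAt.comp z (Complex.hasDerivAt_exp z)).deriv
  have h' : deriv (fun w => g (Complex.exp w)) z =
      deriv g (Complex.exp z) * Complex.exp z := h
  rw [surfaceDeriv, h', Complex.exp_neg]
  field_simp [Complex.exp_ne_zero z]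

/-! ### Function classes -/

/-- `f` belongs to the ultraholomorphic class of the sequence `M` on `S`: it is holomorphic on `S`
and `|f^(j)(z)| ≤ C h ^ j M j` on `S` for all `j`, for some `h > 0` and `C`. -/
def MemSeqClass (M : ℕ → ℝ) (S : Set LogSurface) (f : LogSurface → ℂ) : Prop :=
  DifferentiableOn ℂ f S ∧
    ∃ h > 0, ∃ C : ℝ, ∀ z ∈ S, ∀ j : ℕ, ‖surfaceDeriv^[j] f z‖ ≤ C * (h ^ j * M j)

/-- `f` belongs to the ultraholomorphic class of Roumieu type of the weight matrix `M` on `S`. -/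
def MemClass (M : Idx → ℕ → ℝ) (S : Set LogSurface) (f : LogSurface → ℂ) : Prop :=
  ∃ p, MemSeqClass (M p) S f

/-- `g` is holomorphic on `U ⊆ ℂ` and for each compact `K ⊆ U` there are `p` and `h > 0` such that
`|g^(j)(z)| / (h ^ j M p j)` is bounded in `z ∈ K` and `j`. -/
def MemPlaneClass (M : Idx → ℕ → ℝ) (U : Set ℂ) (g : ℂ → ℂ) : Prop :=
  DifferentiableOn ℂ g U ∧
    ∀ K : Set ℂ, IsCompact K → K ⊆ U → ∃ p, ∃ h > 0, ∃ C : ℝ, ∀ z ∈ K, ∀ j : ℕ,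
      ‖iteratedDeriv j g z‖ ≤ C * (h ^ j * M p j)

/-- The class of `M` on `S` is holomorphically closed. -/
def HolomorphicallyClosed (M : Idx → ℕ → ℝ) (S : Set LogSurface) : Prop :=
  ∀ f : LogSurface → ℂ, MemClass M S f → ∀ U : Set ℂ, IsOpen U → closure (f '' S) ⊆ U →
    ∀ g : ℂ → ℂ, DifferentiableOn ℂ g U → MemClass M S (fun z => g (f z))

/-- The class of `M` on `S` is inverse-closed: it contains `1 / f` whenever it contains `f` and
`|f|` has a positive lower bound on `S`. -/
def InverseClosed (M : Idx → ℕ → ℝ) (S : Set LogSurface) : Prop :=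
  ∀ f : LogSurface → ℂ, MemClass M S f → (∃ c > 0, ∀ z ∈ S, c ≤ ‖f z‖) →
    MemClass M S (fun z => 1 / f z)

/-- The class of `M` on `S` is closed under composition. -/
def CompositionClosed (M : Idx → ℕ → ℝ) (S : Set LogSurface) : Prop :=
  ∀ f : LogSurface → ℂ, MemClass M S f → ∀ U : Set ℂ, IsOpen U → closure (f '' S) ⊆ U →
    ∀ g : ℂ → ℂ, MemPlaneClass M U g → MemClass M S (fun z => g (f z))

end Ultraholo

open Ultraholo

/-!
Up to geometric factors, the assumption on the rows says that `M p j` is `j ^ (j s) * L j` with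
`s = β - 1` and a log-convex sequence `L` depending on `p` (`IsGevreyLogConvex`). Hence every row of
`rami M β` is equivalent to the corresponding row of `M` (`rami_spec`), and both `(M_{rai})` and
`(M_{FdB})` are invariant under equivalence of the rows.

Local holomorphic functions on the surface are functions of `ζ = exp w` through a branch of the
logarithm, so that the Faà di Bruno formula is the composition formula for power series
(`norm_iteratedDeriv_comp_le`). Since `k` has at most `2 ^ k` compositions, `g ∘ f` belongs to the
class as soon as each term of the formula is small (`memSeqClass_comp`). With Cauchy estimates for
`g`, the condition `(M_{rai})` gives closedness under holomorphic functions; with the estimates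
defining the plane class, `(M_{FdB})` gives closedness under composition.

The converse, from inverse-closedness to `(M_{rai})`, rests on a characteristic function of a row.
For `|arg z| < (1 + s) π / 2`, the integral of `exp (-z u ^ s - u)` over `u > 0` can be continued
analytically by turning the ray of integration. Its `j`-th derivative is bounded by
`D ^ (j + 1) * j ^ (j s)`, and for small `z > 0` it has sign `(-1) ^ j` and attains this order of
magnitude. The sum of `2⁻¹ ^ k * (L k / l k ^ k) * e (l k * z)` over `k`, where `e` is this integral
and `l k = L (k + 1) / L k`, then lies in the class of `j ^ (j s) * L j`, and the sizes of its
derivatives near the vertex are those of the weight (`IsGevreyLogConvex.exists_characteristic`). If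
`f` is this function and `λ` is large, the Taylor coefficients of `1 / (λ - f)` at `z > 0` dominate
all products of Taylor coefficients of `f`, because all signs agree (`exists_coeff_inv_sub`). Thus
products of the numbers `M p i / i!` are controlled by a row `M q`. Splitting `k` into parts of
size `j` and one part between `j` and `2 j` turns this into `(M_{rai})`
(`IsGevreyLogConvex.exists_root_le_of_prod_le`).

The same splitting derives `(M_{rai})` from `(M_{FdB})` and `(M_{C^ω})`. Conversely `(M_{dc})` lets
one lower each index `j_i` by one in the product defining `circ`, after which the indices add up to
`k`, and `(M_{rai})` gives `(M_{FdB})` (`CondRai.condFdB`). Finally `(M_{C^ω})` says that the plane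
class contains all holomorphic functions.
-/

namespace Ultraholo

open MeasureTheory Filter Topology

/-! ### Sequences -/

theorem gevreyBar_pos (s : ℝ) (j : ℕ) : 0 < gevreyBar s j := by
  rcases Nat.eq_zero_or_pos j with rfl | hj
  · simp [gevreyBar]
  · exact Real.rpow_pos_of_pos (by exact_mod_cast hj) _

theorem gevreyBar_zero (s : ℝ) : gevreyBar s 0 = 1 := by simp [gevreyBar]

theorem gevreyBar_mul (s t : ℝ) (j : ℕ) :
    gevreyBar s j * gevreyBar t j = gevreyBar (s + t) j := by
  rcases Nat.eq_zero_or_pos j with rfl | hj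
  · simp [gevreyBar]
  · rw [gevreyBar, gevreyBar, gevreyBar, ← Real.rpow_add (by exact_mod_cast hj), mul_add]

theorem gevreyBar_eq_exp (s : ℝ) (j : ℕ) :
    gevreyBar s j = Real.exp (s * (j * Real.log j)) := by
  rcases Nat.eq_zero_or_pos j with rfl | hj
  · simp [gevreyBar]
  · rw [gevreyBar, Real.rpow_def_of_pos (by exact_mod_cast hj)]
    congr 1; ring

theorem isLogConvex_gevreyBar {s : ℝ} (hs : 0 ≤ s) : IsLogConvex (gevreyBar s) := by
  refine ⟨gevreyBar_pos s, fun j => ?_⟩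
  have h := Real.convexOn_mul_log.2 (Set.mem_Ici.2 (Nat.cast_nonneg j))
    (Set.mem_Ici.2 (Nat.cast_nonneg (j + 2))) (by norm_num : (0 : ℝ) ≤ 1 / 2)
    (by norm_num : (0 : ℝ) ≤ 1 / 2) (by norm_num)
  have e : (1 / 2 : ℝ) • (j : ℝ) + (1 / 2 : ℝ) • ((j + 2 : ℕ) : ℝ) = ((j + 1 : ℕ) : ℝ) := by
    push_cast; simp only [smul_eq_mul]; ring
  rw [e] at h
  simp only [smul_eq_mul] at h
  rw [gevreyBar_eq_exp, gevreyBar_eq_exp, gevreyBar_eq_exp, ← Real.exp_add, ← Real.exp_nat_mul]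
  refine Real.exp_le_exp.2 ?_
  have := mul_le_mul_of_nonneg_left h hs
  push_cast at this ⊢
  linarith

theorem IsLogConvex.mul {L N : ℕ → ℝ} (hL : IsLogConvex L) (hN : IsLogConvex N) :
    IsLogConvex (fun j => L j * N j) := by
  refine ⟨fun j => mul_pos (hL.1 j) (hN.1 j), fun j => ?_⟩
  calc (L (j + 1) * N (j + 1)) ^ 2 = L (j + 1) ^ 2 * N (j + 1) ^ 2 := by ring
    _ ≤ (L j * L (j + 2)) * (N j * N (j + 2)) :=
        mul_le_mul (hL.2 j) (hN.2 j) (by positivity) (mul_pos (hL.1 _) (hL.1 _)).le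
    _ = _ := by ring

theorem IsLogConvex.geom_mul {L : ℕ → ℝ} (hL : IsLogConvex L) {c d : ℝ} (hc : 0 < c)
    (hd : 0 < d) : IsLogConvex (fun j => c * d ^ j * L j) := by
  refine ⟨fun j => mul_pos (by positivity) (hL.1 j), fun j => ?_⟩
  calc (c * d ^ (j + 1) * L (j + 1)) ^ 2 = (c * d ^ (j + 1)) ^ 2 * L (j + 1) ^ 2 := by ring
    _ ≤ (c * d ^ (j + 1)) ^ 2 * (L j * L (j + 2)) := by gcongr; exact hL.2 j
    _ = _ := by ring

/-- The quotients `L (k + 1) / L k` of consecutive terms. -/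
noncomputable def quot (L : ℕ → ℝ) (k : ℕ) : ℝ := L (k + 1) / L k

section LogConvex

variable {L : ℕ → ℝ}

theorem IsLogConvex.quot_pos (hL : IsLogConvex L) (k : ℕ) : 0 < quot L k :=
  div_pos (hL.1 _) (hL.1 _)

theorem IsLogConvex.succ_eq (hL : IsLogConvex L) (k : ℕ) : L (k + 1) = quot L k * L k := by
  rw [quot, div_mul_cancel₀ _ (hL.1 k).ne']

theorem IsLogConvex.quot_mono (hL : IsLogConvex L) : Monotone (quot L) := by
  refine monotone_nat_of_le_succ fun k => ?_
  rw [quot, quot, div_le_div_iff₀ (hL.1 _) (hL.1 _)]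
  nlinarith [hL.2 k]

/-- A log-convex sequence lies above each of its supporting geometric progressions. -/
theorem IsLogConvex.mul_quot_pow_le (hL : IsLogConvex L) (k j : ℕ) :
    L k * quot L k ^ j ≤ L j * quot L k ^ k := by
  have hq := hL.quot_pos k
  rcases le_total k j with h | h
  · induction j, h using Nat.le_induction with
    | base => exact le_rfl
    | succ j hkj ih =>
      rw [hL.succ_eq j, pow_succ]
      calc L k * (quot L k ^ j * quot L k) = (L k * quot L k ^ j) * quot L k := by ring
        _ ≤ (L j * quot L k ^ k) * quot L j :=
          mul_le_mul ih (hL.quot_mono hkj) hq.le (mul_pos (hL.1 _) (by positivity)).le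
        _ = _ := by ring
  · suffices H : ∀ i ≤ k, L k * quot L k ^ (k - i) ≤ L (k - i) * quot L k ^ k by
      have := H (k - j) (Nat.sub_le _ _)
      rwa [Nat.sub_sub_self h] at this
    intro i
    induction i with
    | zero => intro _; exact le_rfl
    | succ i ih =>
      intro hi
      have e : k - i = k - (i + 1) + 1 := by omega
      have := ih (by omega)
      rw [e, hL.succ_eq, pow_succ] at this
      have hm : quot L (k - (i + 1)) ≤ quot L k := hL.quot_mono (Nat.sub_le _ _)
      refine le_of_mul_le_mul_right ?_ hq
      calc L k * quot L k ^ (k - (i + 1)) * quot L k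
          = L k * (quot L k ^ (k - (i + 1)) * quot L k) := by ring
        _ ≤ quot L (k - (i + 1)) * L (k - (i + 1)) * quot L k ^ k := this
        _ ≤ quot L k * L (k - (i + 1)) * quot L k ^ k := by
          have := hL.1 (k - (i + 1)); gcongr
        _ = _ := by ring

/-- Roots of the terms of a log-convex sequence increase, after division by `L 0`. -/
theorem IsLogConvex.pow_le_pow (hL : IsLogConvex L) {j k : ℕ} (h : j ≤ k) :
    (L j / L 0) ^ k ≤ (L k / L 0) ^ j := by
  have h0 := hL.1 0
  have hle : ∀ j k : ℕ, j ≤ k → L j / L 0 ≤ quot L k ^ j := by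
    intro j
    induction j with
    | zero => intro k _; simp [h0.ne']
    | succ j ih =>
      intro k hk
      rw [hL.succ_eq, mul_div_assoc, pow_succ']
      exact mul_le_mul (hL.quot_mono (by omega)) (ih k (by omega))
        (div_pos (hL.1 _) h0).le (hL.quot_pos _).le
  have hj := div_pos (hL.1 j) h0
  induction k, h using Nat.le_induction with
  | base => exact le_rfl
  | succ k hjk ih =>
    rw [pow_succ, hL.succ_eq k, mul_div_assoc, mul_pow, mul_comm]
    have := hL.quot_pos k
    exact mul_le_mul (hle j k hjk) ih (by positivity) (by positivity)

end LogConvex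

/-! ### Comparison of sequences -/

/-- The two constants in `M ≼ L` merged into one. -/
theorem SeqLE.exists_one_le {M L : ℕ → ℝ} (h : SeqLE M L) (hL : ∀ j, 0 ≤ L j) :
    ∃ D : ℝ, 1 ≤ D ∧ ∀ j, M j ≤ D ^ (j + 1) * L j := by
  obtain ⟨A, hA, B, hB, h⟩ := h
  refine ⟨max 1 (max A B), le_max_left _ _, fun j => (h j).trans ?_⟩
  have h1 : A ≤ max 1 (max A B) := le_max_of_le_right (le_max_left _ _)
  have h2 : B ≤ max 1 (max A B) := le_max_of_le_right (le_max_right _ _)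
  have := hL j
  rw [pow_succ']
  gcongr

theorem seqLE_of_pow_succ {M L : ℕ → ℝ} {D : ℝ} (hD : 0 < D)
    (h : ∀ j, M j ≤ D ^ (j + 1) * L j) : SeqLE M L :=
  ⟨D, hD, D, hD, fun j => by rw [← pow_succ']; exact h j⟩

theorem SeqLE.trans {M L N : ℕ → ℝ} (h : SeqLE M L) (h' : SeqLE L N) : SeqLE M N := by
  obtain ⟨A, hA, B, hB, h⟩ := h
  obtain ⟨A', hA', B', hB', h'⟩ := h'
  refine ⟨A * A', mul_pos hA hA', B * B', mul_pos hB hB', fun j => (h j).trans ?_⟩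
  calc A * B ^ j * L j ≤ A * B ^ j * (A' * B' ^ j * N j) := by gcongr; exact h' j
    _ = _ := by ring

theorem SeqLE.mul_left {M L : ℕ → ℝ} (h : SeqLE M L) {G : ℕ → ℝ} (hG : ∀ j, 0 ≤ G j) :
    SeqLE (fun j => G j * M j) (fun j => G j * L j) := by
  obtain ⟨A, hA, B, hB, h⟩ := h
  refine ⟨A, hA, B, hB, fun j => ?_⟩
  calc G j * M j ≤ G j * (A * B ^ j * L j) := mul_le_mul_of_nonneg_left (h j) (hG j)
    _ = _ := by ring

theorem SeqLE.of_le {M L : ℕ → ℝ} (h : ∀ j, M j ≤ L j) : SeqLE M L :=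
  ⟨1, one_pos, 1, one_pos, fun j => by simpa using h j⟩

theorem seqLE_check {M L : ℕ → ℝ} (h : SeqLE M L) : SeqLE (check M) (check L) := by
  have := h.mul_left (G := fun j => ((j.factorial : ℝ))⁻¹) (fun j => by positivity)
  have e : ∀ N : ℕ → ℝ, check N = fun j => ((j.factorial : ℝ))⁻¹ * N j := fun N => by
    funext j; rw [check, div_eq_inv_mul]
  rwa [e, e]

theorem check_pos {M : ℕ → ℝ} (h : ∀ j, 0 < M j) (j : ℕ) : 0 < check M j :=
  div_pos (h j) (by positivity)

theorem check_le_check {M N : ℕ → ℝ} {j : ℕ} (h : M j ≤ N j) : check M j ≤ check N j := by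
  unfold check; gcongr

/-! ### Roots -/

theorem rpow_one_div_pow {x : ℝ} (hx : 0 ≤ x) {j : ℕ} (hj : 1 ≤ j) :
    (x ^ (1 / (j : ℝ))) ^ j = x := by
  rw [one_div]; exact Real.rpow_inv_natCast_pow hx (by omega)

theorem pow_rpow_one_div {x : ℝ} (hx : 0 ≤ x) {j : ℕ} (hj : 1 ≤ j) :
    (x ^ j) ^ (1 / (j : ℝ)) = x := by
  rw [one_div]; exact Real.pow_rpow_inv_natCast hx (by omega)

theorem rpow_one_div_le_of_le_pow_mul {x y C : ℝ} (hx : 0 ≤ x) (hy : 0 ≤ y) (hC : 0 ≤ C) {j : ℕ}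
    (hj : 1 ≤ j) (h : x ≤ C ^ j * y) : x ^ (1 / (j : ℝ)) ≤ C * y ^ (1 / (j : ℝ)) := by
  calc x ^ (1 / (j : ℝ)) ≤ (C ^ j * y) ^ (1 / (j : ℝ)) :=
        Real.rpow_le_rpow hx h (by positivity)
    _ = C * y ^ (1 / (j : ℝ)) := by
        rw [Real.mul_rpow (by positivity) hy, pow_rpow_one_div hC hj]

theorem pow_succ_le_sq_pow {D : ℝ} (hD : 1 ≤ D) {j : ℕ} (hj : 1 ≤ j) :
    D ^ (j + 1) ≤ (D ^ 2) ^ j := by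
  rw [← pow_mul]; exact pow_le_pow_right₀ hD (by omega)

theorem SeqLE.exists_root_le {M L : ℕ → ℝ} (h : SeqLE M L) (hM : ∀ j, 0 < M j)
    (hL : ∀ j, 0 < L j) :
    ∃ C : ℝ, 1 ≤ C ∧ ∀ j : ℕ, 1 ≤ j → M j ^ (1 / (j : ℝ)) ≤ C * L j ^ (1 / (j : ℝ)) := by
  obtain ⟨D, hD, h⟩ := h.exists_one_le (fun j => (hL j).le)
  refine ⟨D ^ 2, one_le_pow₀ hD, fun j hj => ?_⟩
  refine rpow_one_div_le_of_le_pow_mul (hM j).le (hL j).le (by positivity) hj ?_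
  exact (h j).trans (mul_le_mul_of_nonneg_right (pow_succ_le_sq_pow hD hj) (hL j).le)

theorem IsLogConvex.exists_root_le {L : ℕ → ℝ} (hL : IsLogConvex L) :
    ∃ C : ℝ, 1 ≤ C ∧ ∀ j k : ℕ, 1 ≤ j → j ≤ k →
      L j ^ (1 / (j : ℝ)) ≤ C * L k ^ (1 / (k : ℝ)) := by
  have h0 := hL.1 0
  -- passing to `L j / L 0` and back costs the bounded factors `L 0 ^ (1 / j)`
  obtain ⟨C, hC, h1⟩ := SeqLE.exists_root_le (M := L) (L := fun j => L j / L 0)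
    ⟨L 0, h0, 1, one_pos, fun j => by simp [mul_div_cancel₀ _ h0.ne']⟩ hL.1
    (fun j => div_pos (hL.1 j) h0)
  obtain ⟨C', hC', h2⟩ := SeqLE.exists_root_le (L := L) (M := fun j => L j / L 0)
    ⟨(L 0)⁻¹, inv_pos.2 h0, 1, one_pos, fun j => by simp [div_eq_inv_mul]⟩
    (fun j => div_pos (hL.1 j) h0) hL.1
  refine ⟨C * C', one_le_mul_of_one_le_of_one_le hC hC', fun j k hj hjk => ?_⟩
  have hk : 1 ≤ k := hj.trans hjk
  have h3 : (L j / L 0) ^ (1 / (j : ℝ)) ≤ (L k / L 0) ^ (1 / (k : ℝ)) := by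
    have hx := (div_pos (hL.1 j) h0).le
    have hy := (div_pos (hL.1 k) h0).le
    refine le_of_pow_le_pow_left₀ (n := j * k) (by positivity) (by positivity) ?_
    rw [pow_mul, rpow_one_div_pow hx hj, mul_comm, pow_mul, rpow_one_div_pow hy hk]
    exact hL.pow_le_pow hjk
  calc L j ^ (1 / (j : ℝ)) ≤ C * (L j / L 0) ^ (1 / (j : ℝ)) := h1 j hj
    _ ≤ C * (C' * L k ^ (1 / (k : ℝ))) := by
        gcongr; exact h3.trans (h2 k hk)
    _ = _ := by ring

theorem gevreyBar_root (s : ℝ) {j : ℕ} (hj : 1 ≤ j) :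
    gevreyBar s j ^ (1 / (j : ℝ)) = (j : ℝ) ^ s := by
  rw [gevreyBar, ← Real.rpow_mul (by positivity)]
  congr 1
  have : (j : ℝ) ≠ 0 := by positivity
  field_simp

theorem le_mul_factorial_root {j : ℕ} (hj : 1 ≤ j) :
    (j : ℝ) ≤ Real.exp 1 * (j.factorial : ℝ) ^ (1 / (j : ℝ)) := by
  have h := Real.pow_div_factorial_le_exp (x := (j : ℝ)) (by positivity) j
  rw [div_le_iff₀ (by positivity)] at h
  have e : Real.exp (j : ℝ) = Real.exp 1 ^ j := by rw [← Real.exp_nat_mul]; simp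
  rw [e] at h
  have := rpow_one_div_le_of_le_pow_mul (by positivity) (by positivity) (Real.exp_pos 1).le hj h
  rwa [pow_rpow_one_div (by positivity) hj] at this

theorem factorial_root_le {j : ℕ} (hj : 1 ≤ j) :
    (j.factorial : ℝ) ^ (1 / (j : ℝ)) ≤ j := by
  have : (j.factorial : ℝ) ≤ (j : ℝ) ^ j := by exact_mod_cast Nat.factorial_le_pow j
  calc _ ≤ ((j : ℝ) ^ j) ^ (1 / (j : ℝ)) := Real.rpow_le_rpow (by positivity) this (by positivity)
    _ = j := pow_rpow_one_div (by positivity) hj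

/-! ### Weight sequences of the form `gevreyBar s * L` with `L` log-convex -/

/-- The structural assumption on the rows: `N` is equivalent to `gevreyBar s * L` for some
log-convex sequence `L`. -/
def IsGevreyLogConvex (s : ℝ) (N : ℕ → ℝ) : Prop :=
  ∃ L : ℕ → ℝ, IsLogConvex L ∧ SeqEquiv N (fun j => gevreyBar s j * L j)

theorem isGevreyLogConvex_of_seqEquiv {s : ℝ} {N L : ℕ → ℝ} (hL : IsLogConvex L)
    (h : SeqEquiv (fun j => gevreyBar (-s) j * N j) L) : IsGevreyLogConvex s N := by
  have e : (fun j => gevreyBar s j * (gevreyBar (-s) j * N j)) = N := by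
    funext j
    have h0 : gevreyBar (0 : ℝ) j = 1 := by simp [gevreyBar]
    rw [← mul_assoc, gevreyBar_mul, add_neg_cancel, h0, one_mul]
  have h1 := h.1.mul_left (fun j => (gevreyBar_pos s j).le)
  have h2 := h.2.mul_left (fun j => (gevreyBar_pos s j).le)
  rw [e] at h1 h2
  exact ⟨L, hL, h1, h2⟩

theorem SeqEquiv.symm {M L : ℕ → ℝ} (h : SeqEquiv M L) : SeqEquiv L M := ⟨h.2, h.1⟩

theorem IsGevreyLogConvex.of_le {s t : ℝ} (hst : s ≤ t) {N : ℕ → ℝ}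
    (h : IsGevreyLogConvex t N) : IsGevreyLogConvex s N := by
  obtain ⟨L, hL, h⟩ := h
  refine ⟨fun j => gevreyBar (t - s) j * L j,
    (isLogConvex_gevreyBar (sub_nonneg.2 hst)).mul hL, ?_⟩
  have e : (fun j => gevreyBar s j * (gevreyBar (t - s) j * L j)) =
      fun j => gevreyBar t j * L j := by
    funext j
    rw [← mul_assoc, gevreyBar_mul, add_sub_cancel]
  rwa [e]

/-- For `N` as in `IsGevreyLogConvex`, `(N j / j!) ^ (1 / j)` is almost increasing along
dyadic ranges. -/
theorem IsGevreyLogConvex.exists_root_check_le {s : ℝ} (hs : 0 ≤ s) {N : ℕ → ℝ}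
    (hN : ∀ j, 0 < N j) (h : IsGevreyLogConvex s N) :
    ∃ C : ℝ, 1 ≤ C ∧ ∀ j k : ℕ, 1 ≤ j → j ≤ k → k ≤ 2 * j →
      check N j ^ (1 / (j : ℝ)) ≤ C * check N k ^ (1 / (k : ℝ)) := by
  obtain ⟨L, hL, h1, h2⟩ := h
  have hG : IsLogConvex (fun j => gevreyBar s j * L j) := (isLogConvex_gevreyBar hs).mul hL
  obtain ⟨C₁, hC₁, h1⟩ := h1.exists_root_le hN hG.1
  obtain ⟨C₂, hC₂, h2⟩ := h2.exists_root_le hG.1 hN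
  obtain ⟨C₃, hC₃, h3⟩ := hG.exists_root_le
  have he : (1 : ℝ) ≤ Real.exp 1 := Real.one_le_exp (by norm_num)
  refine ⟨2 * Real.exp 1 * (C₁ * C₃ * C₂), ?_, fun j k hj hjk hk => ?_⟩
  · have := one_le_mul_of_one_le_of_one_le (one_le_mul_of_one_le_of_one_le hC₁ hC₃) hC₂
    nlinarith
  have hk1 : 1 ≤ k := hj.trans hjk
  unfold check
  rw [Real.div_rpow (hN j).le (by positivity), Real.div_rpow (hN k).le (by positivity)]
  have hA : N j ^ (1 / (j : ℝ)) ≤ C₁ * C₃ * C₂ * N k ^ (1 / (k : ℝ)) := by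
    calc _ ≤ C₁ * _ := h1 j hj
      _ ≤ C₁ * (C₃ * (C₂ * N k ^ (1 / (k : ℝ)))) := by
        gcongr
        exact (h3 j k hj hjk).trans (by gcongr; exact h2 k hk1)
      _ = _ := by ring
  have hF : (k.factorial : ℝ) ^ (1 / (k : ℝ)) ≤
      2 * Real.exp 1 * (j.factorial : ℝ) ^ (1 / (j : ℝ)) := by
    calc _ ≤ (k : ℝ) := factorial_root_le hk1
      _ ≤ 2 * (j : ℝ) := by exact_mod_cast hk
      _ ≤ 2 * (Real.exp 1 * (j.factorial : ℝ) ^ (1 / (j : ℝ))) := by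
        gcongr; exact le_mul_factorial_root hj
      _ = _ := by ring
  have hNk := Real.rpow_pos_of_pos (hN k) (1 / (k : ℝ))
  rw [mul_div_assoc', div_le_div_iff₀ (by positivity) (by positivity)]
  calc _ ≤ (C₁ * C₃ * C₂ * N k ^ (1 / (k : ℝ))) *
        (2 * Real.exp 1 * (j.factorial : ℝ) ^ (1 / (j : ℝ))) := by gcongr
    _ = _ := by ring

theorem IsGevreyLogConvex.tendsto_root {s : ℝ} (hs : 0 < s) {N : ℕ → ℝ} (hN : ∀ j, 0 < N j)
    (h : IsGevreyLogConvex s N) :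
    Filter.Tendsto (fun j : ℕ => N j ^ (1 / (j : ℝ))) Filter.atTop Filter.atTop := by
  obtain ⟨L, hL, -, h⟩ := h
  have hq := hL.quot_pos 0
  obtain ⟨C, hC, h⟩ := (SeqLE.trans (M := fun j => gevreyBar s j * quot L 0 ^ j)
    ⟨(L 0)⁻¹, inv_pos.2 (hL.1 0), 1, one_pos, fun j => by
      have h1 := hL.mul_quot_pow_le 0 j
      rw [one_pow, mul_one, pow_zero, mul_one] at *
      rw [← div_eq_inv_mul, le_div_iff₀ (hL.1 0)]
      have := gevreyBar_pos s j
      calc _ = gevreyBar s j * (L 0 * quot L 0 ^ j) := by ring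
        _ ≤ _ := by gcongr⟩ h).exists_root_le
    (fun j => mul_pos (gevreyBar_pos s j) (pow_pos hq j)) hN
  have ht : Filter.Tendsto (fun j : ℕ => (quot L 0 / C) * (j : ℝ) ^ s)
      Filter.atTop Filter.atTop :=
    ((tendsto_rpow_atTop hs).comp tendsto_natCast_atTop_atTop).const_mul_atTop
      (by positivity)
  refine Filter.tendsto_atTop_mono' _ ?_ ht
  filter_upwards [Filter.eventually_ge_atTop 1] with j hj
  have := h j hj
  rw [Real.mul_rpow (gevreyBar_pos s j).le (by positivity), gevreyBar_root s hj,
    pow_rpow_one_div hq.le hj] at this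
  rw [div_mul_eq_mul_div, div_le_iff₀ (by positivity)]
  linarith

/-! ### The log-convex minorant -/

theorem le_lcMinorant {N L : ℕ → ℝ} (hL : IsLogConvex L) (h : ∀ i, L i ≤ N i) (j : ℕ) :
    L j ≤ lcMinorant N j :=
  le_csSup ⟨N j, by rintro x ⟨L', -, h', rfl⟩; exact h' j⟩ ⟨L, hL, h, rfl⟩

theorem lcMinorant_le {N L : ℕ → ℝ} (hL : IsLogConvex L) (h : ∀ i, L i ≤ N i) (j : ℕ) :
    lcMinorant N j ≤ N j :=
  csSup_le ⟨L j, L, hL, h, rfl⟩ (by rintro x ⟨L', -, h', rfl⟩; exact h' j)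

/-- A sequence equivalent to a log-convex one is equivalent to its log-convex minorant. -/
theorem lcMinorant_spec {N L : ℕ → ℝ} (hL : IsLogConvex L) (h : SeqEquiv N L) :
    (∀ j, 0 < lcMinorant N j) ∧ SeqEquiv (lcMinorant N) N := by
  obtain ⟨h1, A, hA, B, hB, h2⟩ := h
  -- a log-convex sequence below `N` and equivalent to `N`
  have hL' : IsLogConvex (fun j => A⁻¹ * B⁻¹ ^ j * L j) :=
    hL.geom_mul (inv_pos.2 hA) (inv_pos.2 hB)
  have hle : ∀ j, A⁻¹ * B⁻¹ ^ j * L j ≤ N j := fun j => by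
    calc _ ≤ A⁻¹ * B⁻¹ ^ j * (A * B ^ j * N j) := by gcongr; exact h2 j
      _ = N j := by rw [inv_pow]; field_simp
  refine ⟨fun j => (hL'.1 j).trans_le (le_lcMinorant hL' hle j),
    SeqLE.of_le (lcMinorant_le hL' hle), h1.trans ⟨A, hA, B, hB, fun j => ?_⟩⟩
  calc L j = A * B ^ j * (A⁻¹ * B⁻¹ ^ j * L j) := by rw [inv_pow]; field_simp
    _ ≤ _ := by gcongr; exact le_lcMinorant hL' hle j

/-! ### Conditions on weight matrices -/

theorem le_circ (N : ℕ → ℝ) {k : ℕ} (hk : k ≠ 0) (c : Composition k) :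
    N c.length * ∏ i : Fin c.length, N (c.blocksFun i) ≤ circ N k := by
  rw [circ, if_neg hk]
  exact Finset.le_sup' (fun c : Composition k => N c.length * ∏ i : Fin c.length, N (c.blocksFun i))
    (Finset.mem_univ c)

theorem circ_le {N : ℕ → ℝ} {k : ℕ} (hk : k ≠ 0) {x : ℝ}
    (h : ∀ c : Composition k, N c.length * ∏ i : Fin c.length, N (c.blocksFun i) ≤ x) :
    circ N k ≤ x := by
  rw [circ, if_neg hk]
  exact Finset.sup'_le _ _ fun c _ => h c

theorem prod_pow_blocksFun {k : ℕ} (c : Composition k) (x : ℝ) :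
    ∏ i : Fin c.length, x ^ c.blocksFun i = x ^ k := by
  rw [Finset.prod_pow_eq_pow_sum, c.sum_blocksFun]

theorem SeqLE.circ {N N' : ℕ → ℝ} (h : SeqLE N N') (hN : ∀ j, 0 < N j) (hN' : ∀ j, 0 < N' j) :
    SeqLE (circ N) (circ N') := by
  obtain ⟨D, hD, h⟩ := h.exists_one_le (fun j => (hN' j).le)
  have hD0 : 0 < D := one_pos.trans_le hD
  refine seqLE_of_pow_succ (D := D ^ 3) (by positivity) fun k => ?_
  rcases eq_or_ne k 0 with rfl | hk
  · simp only [Ultraholo.circ, if_true, zero_add, pow_one, mul_one]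
    exact one_le_pow₀ hD
  · refine circ_le hk fun c => ?_
    have hl := c.length_le
    calc N c.length * ∏ i : Fin c.length, N (c.blocksFun i)
        ≤ (D ^ (c.length + 1) * N' c.length) *
          ∏ i : Fin c.length, (D ^ (c.blocksFun i + 1) * N' (c.blocksFun i)) :=
          mul_le_mul (h _) (Finset.prod_le_prod (fun i _ => (hN _).le) fun i _ => h _)
            (Finset.prod_nonneg fun i _ => (hN _).le) (mul_pos (by positivity) (hN' _)).le
      _ = D ^ (c.length + 1 + k + c.length) *
          (N' c.length * ∏ i : Fin c.length, N' (c.blocksFun i)) := by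
          rw [Finset.prod_mul_distrib]
          simp only [pow_succ]
          rw [Finset.prod_mul_distrib, prod_pow_blocksFun]
          simp only [Finset.prod_const, Finset.card_univ, Fintype.card_fin]
          ring
      _ ≤ (D ^ 3) ^ (k + 1) * Ultraholo.circ N' k := by
          rw [← pow_mul]
          refine mul_le_mul (pow_le_pow_right₀ hD (by omega)) (le_circ N' hk c) ?_ (by positivity)
          exact mul_nonneg (hN' _).le (Finset.prod_nonneg fun i _ => (hN' _).le)

section Equiv

variable {M N : Idx → ℕ → ℝ} (hM : ∀ p j, 0 < M p j) (hN : ∀ p j, 0 < N p j)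
  (h : ∀ p, SeqEquiv (M p) (N p))

include hM hN h

theorem CondRai.of_seqEquiv (hr : CondRai M) : CondRai N := by
  intro p
  obtain ⟨C, hC, q, hq⟩ := hr p
  obtain ⟨C₁, hC₁, h1⟩ := (seqLE_check (h p).2).exists_root_le (check_pos (hN p)) (check_pos (hM p))
  obtain ⟨C₂, hC₂, h2⟩ := (seqLE_check (h q).1).exists_root_le (check_pos (hM q)) (check_pos (hN q))
  refine ⟨C₁ * C * C₂, by positivity, q, fun j k hj hjk => ?_⟩
  calc _ ≤ C₁ * _ := h1 j hj
    _ ≤ C₁ * (C * (C₂ * check (N q) k ^ (1 / (k : ℝ)))) := by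
      gcongr
      exact (hq j k hj hjk).trans (by gcongr; exact h2 k (hj.trans hjk))
    _ = _ := by ring

theorem CondFdB.of_seqEquiv (hr : CondFdB M) : CondFdB N := by
  intro p
  obtain ⟨q, hq⟩ := hr p
  exact ⟨q, ((seqLE_check (h p).2).circ (check_pos (hN p)) (check_pos (hM p))).trans
    (hq.trans (seqLE_check (h q).1))⟩

end Equiv

section WeightMatrix

variable {M : Idx → ℕ → ℝ} (hM : IsWeightMatrix M)

include hM

theorem IsWeightMatrix.check_pos (p : Idx) (j : ℕ) : 0 < check (M p) j :=
  Ultraholo.check_pos (hM.pos p) j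

theorem IsWeightMatrix.check_zero (p : Idx) : check (M p) 0 = 1 := by simp [check, hM.zero p]

theorem IsWeightMatrix.check_mono {p q : Idx} (h : p ≤ q) (j : ℕ) :
    check (M p) j ≤ check (M q) j := check_le_check (hM.mono p q h j)

/-- The condition `(M_{rai})` with roots removed, and with `j = 0` included. -/
theorem CondRai.exists_le_pow (hr : CondRai M) (p : Idx) :
    ∃ C : ℝ, 1 ≤ C ∧ ∃ q, ∀ j k : ℕ, 1 ≤ k → j ≤ k →
      check (M p) j ≤ (C * check (M q) k ^ (1 / (k : ℝ))) ^ j := by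
  obtain ⟨C, hC, q, h⟩ := hr p
  refine ⟨max 1 C, le_max_left _ _, q, fun j k hk hjk => ?_⟩
  have hmk := hM.check_pos q k
  have hmj := hM.check_pos p j
  rcases Nat.eq_zero_or_pos j with rfl | hj
  · rw [hM.check_zero, pow_zero]
  · calc check (M p) j = (check (M p) j ^ (1 / (j : ℝ))) ^ j := (rpow_one_div_pow hmj.le hj).symm
      _ ≤ (C * check (M q) k ^ (1 / (k : ℝ))) ^ j := by gcongr; exact h j k hj hjk
      _ ≤ _ := by gcongr; exact le_max_right _ _

theorem CondRai.exists_prod_le (hr : CondRai M) (p : Idx) :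
    ∃ C : ℝ, 1 ≤ C ∧ ∃ q, ∀ (k : ℕ) (c : Composition k),
      ∏ i : Fin c.length, check (M p) (c.blocksFun i) ≤ C ^ k * check (M q) k := by
  obtain ⟨C, hC, q, h⟩ := hr.exists_le_pow hM p
  refine ⟨C, hC, q, fun k c => ?_⟩
  rcases Nat.eq_zero_or_pos k with rfl | hk
  · have : c.length = 0 := by have := c.length_le; omega
    rw [pow_zero, one_mul, hM.check_zero]
    have : IsEmpty (Fin c.length) := by rw [this]; infer_instance
    simp
  · calc _ ≤ ∏ i : Fin c.length, (C * check (M q) k ^ (1 / (k : ℝ))) ^ c.blocksFun i :=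
        Finset.prod_le_prod (fun i _ => (hM.check_pos p _).le) fun i _ =>
          h _ _ hk (c.blocksFun_le i)
      _ = C ^ k * check (M q) k := by
        rw [prod_pow_blocksFun, mul_pow, rpow_one_div_pow (hM.check_pos q k).le hk]

/-- Derivation closedness replaces each block `j` of a composition of `k` by `j - 1`. The indices
in the product defining `circ` then add up to `k` again, and `(M_{rai})` applies. -/
theorem CondRai.condFdB (hr : CondRai M) (hd : CondDc M) : CondFdB M := by
  intro p
  obtain ⟨C₁, hC₁, q₁, h1⟩ := hd p
  obtain ⟨C, hC, q, h⟩ := hr.exists_le_pow hM (max p q₁)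
  refine ⟨q, ⟨1, one_pos, C₁ * C, by positivity, fun k => ?_⟩⟩
  rcases eq_or_ne k 0 with rfl | hk0
  · simp [circ, hM.check_zero]
  have hk : 1 ≤ k := by omega
  refine circ_le hk0 fun c => ?_
  set x := C * check (M q) k ^ (1 / (k : ℝ)) with hx
  have hx0 : 0 < x := mul_pos (by positivity) (Real.rpow_pos_of_pos (hM.check_pos q k) _)
  have hdc : ∀ j, check (M p) (j + 1) ≤ C₁ ^ (j + 1) * check (M q₁) j := fun j => by
    unfold check
    rw [mul_div_assoc']
    have := hM.pos q₁ j
    have hf : (j.factorial : ℝ) ≤ ((j + 1).factorial : ℝ) := by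
      exact_mod_cast Nat.factorial_le (Nat.le_succ j)
    exact div_le_div₀ (by positivity) (h1 j) (by positivity) hf
  have hb : ∀ i : Fin c.length, check (M p) (c.blocksFun i) * x ≤ (C₁ * x) ^ c.blocksFun i := by
    intro i
    obtain ⟨j, hj⟩ : ∃ j, c.blocksFun i = j + 1 := ⟨_, (Nat.succ_pred (by
      have := c.one_le_blocksFun i; omega)).symm⟩
    have hle := c.blocksFun_le i
    rw [hj] at hle ⊢
    calc check (M p) (j + 1) * x ≤ (C₁ ^ (j + 1) * x ^ j) * x := by
          gcongr
          refine (hdc j).trans ?_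
          gcongr
          exact (hM.check_mono (le_max_right p q₁) j).trans (h j k hk (by omega))
      _ = _ := by rw [mul_pow]; ring
  calc check (M p) c.length * ∏ i : Fin c.length, check (M p) (c.blocksFun i)
      ≤ x ^ c.length * ∏ i : Fin c.length, check (M p) (c.blocksFun i) := by
        have hp : 0 ≤ ∏ i : Fin c.length, check (M p) (c.blocksFun i) :=
          Finset.prod_nonneg fun i _ => (hM.check_pos p _).le
        gcongr
        exact (hM.check_mono (le_max_left p q₁) _).trans (h _ k hk c.length_le)
    _ = ∏ i : Fin c.length, (check (M p) (c.blocksFun i) * x) := by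
        rw [Finset.prod_mul_distrib, mul_comm]; simp
    _ ≤ ∏ i : Fin c.length, (C₁ * x) ^ c.blocksFun i :=
        Finset.prod_le_prod (fun i _ => (mul_pos (hM.check_pos p _) hx0).le) fun i _ => hb i
    _ = 1 * (C₁ * C) ^ k * check (M q) k := by
        rw [prod_pow_blocksFun, hx, mul_pow, mul_pow, mul_pow,
          rpow_one_div_pow (hM.check_pos q k).le hk]
        ring

theorem CondComega.exists_seqLE (hc : CondComega M) :
    ∃ p, SeqLE (fun _ => 1) (check (M p)) := by
  obtain ⟨p, hp⟩ := hc
  obtain ⟨δ, hδ0, hδ⟩ := exists_between hp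
  have hδt : δ ≠ ⊤ := ne_top_of_lt hδ
  have hδ' : 0 < δ.toReal := ENNReal.toReal_pos hδ0.ne' hδt
  have hev := Filter.eventually_lt_of_lt_liminf hδ
  obtain ⟨n, hn⟩ := Filter.eventually_atTop.1 hev
  refine ⟨p, ?_⟩
  obtain ⟨A, hA⟩ := ((Finset.range (n + 1)).image fun j => (δ.toReal⁻¹ ^ j * check (M p) j)⁻¹).bddAbove
  refine ⟨max 1 A, by positivity, δ.toReal⁻¹, inv_pos.2 hδ', fun j => ?_⟩
  have hm := hM.check_pos p j
  have hpos : 0 < δ.toReal⁻¹ ^ j * check (M p) j := by positivity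
  rw [mul_assoc]
  rcases lt_or_ge j (n + 1) with h | h
  · have : (δ.toReal⁻¹ ^ j * check (M p) j)⁻¹ ≤ A :=
      hA (Finset.mem_coe.2 (Finset.mem_image_of_mem _ (Finset.mem_range.2 h)))
    rw [inv_le_iff_one_le_mul₀ hpos] at this
    exact this.trans (by gcongr; exact le_max_right _ _)
  · have h1 : δ.toReal ≤ check (M p) j ^ (1 / (j : ℝ)) := by
      have := (hn j (by omega)).le
      exact ENNReal.toReal_le_of_le_ofReal (by positivity) this
    have h2 : δ.toReal ^ j ≤ check (M p) j := by
      rw [← rpow_one_div_pow hm.le (show 1 ≤ j by omega)]; gcongr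
    have h3 : 1 ≤ δ.toReal⁻¹ ^ j * check (M p) j := by
      rw [inv_pow, ← div_eq_inv_mul, one_le_div (by positivity)]; exact h2
    exact h3.trans (le_mul_of_one_le_left hpos.le (le_max_left _ _))

end WeightMatrix

/-- If products of terms of `check N` over lists are controlled by `check Q`, then
`check N` and `check Q` satisfy the inequality of `(M_{rai})`: for `j ≤ k`, split `k` into parts
of size `j` and one part of size between `j` and `2 j`. -/
theorem IsGevreyLogConvex.exists_root_le_of_prod_le {s : ℝ} (hs : 0 ≤ s) {N Q : ℕ → ℝ}
    (hN : ∀ j, 0 < N j) (h : IsGevreyLogConvex s N) (hQ : ∀ j, 0 < Q j) {D : ℝ} (hD : 1 ≤ D)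
    (hprod : ∀ l : List ℕ, l ≠ [] → (∀ i ∈ l, 1 ≤ i) →
      (l.map (check N)).prod ≤ D ^ (l.sum + 1) * check Q l.sum) :
    ∃ C > 0, ∀ j k : ℕ, 1 ≤ j → j ≤ k →
      check N j ^ (1 / (j : ℝ)) ≤ C * check Q k ^ (1 / (k : ℝ)) := by
  obtain ⟨C, hC, hroot⟩ := h.exists_root_check_le hs hN
  refine ⟨C * D ^ 2, by positivity, fun j k hj hjk => ?_⟩
  have hk : 1 ≤ k := hj.trans hjk
  -- `n` parts of size `j` and a last one of size `j + r < 2 * j`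
  obtain ⟨n, r, hkr, hr⟩ : ∃ n r, k = n * j + (j + r) ∧ r < j := by
    refine ⟨k / j - 1, k % j, ?_, Nat.mod_lt _ hj⟩
    have h1 : 1 ≤ k / j := (Nat.one_le_div_iff hj).2 hjk
    have h2 := Nat.div_add_mod' k j
    have h3 : (k / j - 1) * j + j = k / j * j := by
      rw [← Nat.succ_mul, Nat.succ_eq_add_one, Nat.sub_add_cancel h1]
    omega
  set x := check N j ^ (1 / (j : ℝ)) with hx
  have hx0 : 0 < x := Real.rpow_pos_of_pos (check_pos hN j) _
  have hxj : x ^ j = check N j := rpow_one_div_pow (check_pos hN j).le hj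
  have hl := hprod ((j + r) :: List.replicate n j) (by simp) (by
    intro i hi
    rcases List.mem_cons.1 hi with rfl | hi
    · omega
    · rw [List.eq_of_mem_replicate hi]; exact hj)
  simp only [List.map_cons, List.prod_cons, List.map_replicate, List.prod_replicate,
    List.sum_cons, List.sum_replicate, smul_eq_mul] at hl
  rw [show j + r + n * j = k by omega] at hl
  have hjr : x ^ (j + r) ≤ C ^ (j + r) * check N (j + r) := by
    have := hroot j (j + r) hj (by omega) (by omega)
    calc x ^ (j + r) ≤ (C * check N (j + r) ^ (1 / ((j + r : ℕ) : ℝ))) ^ (j + r) := by gcongr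
      _ = _ := by rw [mul_pow, rpow_one_div_pow (check_pos hN _).le (by omega)]
  have hmain : x ^ k ≤ (C * D ^ 2) ^ k * check Q k := by
    calc x ^ k = x ^ (j + r) * (x ^ j) ^ n := by rw [← pow_mul, ← pow_add]; congr 1; rw [hkr]; ring
      _ ≤ (C ^ (j + r) * check N (j + r)) * (check N j) ^ n := by
          rw [hxj]
          have := check_pos hN j
          gcongr
      _ = C ^ (j + r) * (check N (j + r) * check N j ^ n) := by ring
      _ ≤ C ^ k * ((D ^ 2) ^ k * check Q k) := by
          have h1 := check_pos hN (j + r)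
          have h2 := check_pos hN j
          have h3 := check_pos hQ k
          refine mul_le_mul (pow_le_pow_right₀ hC (by omega)) (hl.trans ?_) (by positivity)
            (by positivity)
          gcongr
          exact pow_succ_le_sq_pow hD hk
      _ = _ := by rw [mul_pow C]; ring
  have := rpow_one_div_le_of_le_pow_mul (by positivity) (check_pos hQ k).le (by positivity) hk hmain
  rwa [pow_rpow_one_div hx0.le hk] at this

theorem IsWeightMatrix.condRai_of_prod_le {M : Idx → ℕ → ℝ} (hM : IsWeightMatrix M) {s : Idx → ℝ}
    (hs : ∀ p, 0 ≤ s p) (h : ∀ p, IsGevreyLogConvex (s p) (M p))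
    (hprod : ∀ p, ∃ p', p ≤ p' ∧ ∃ q, ∃ D : ℝ, 1 ≤ D ∧ ∀ l : List ℕ, l ≠ [] → (∀ i ∈ l, 1 ≤ i) →
      (l.map (check (M p'))).prod ≤ D ^ (l.sum + 1) * check (M q) l.sum) : CondRai M := by
  intro p
  obtain ⟨p', hp, q, D, hD, hl⟩ := hprod p
  obtain ⟨C, hC, hCl⟩ :=
    (h p').exists_root_le_of_prod_le (hs p') (hM.pos p') (hM.pos q) hD hl
  refine ⟨C, hC, q, fun j k hj hjk => (Real.rpow_le_rpow (hM.check_pos p j).le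
    (hM.check_mono hp j) (by positivity)).trans (hCl j k hj hjk)⟩

theorem CondFdB.condRai {M : Idx → ℕ → ℝ} (hf : CondFdB M) (hM : IsWeightMatrix M) {s : Idx → ℝ}
    (hs : ∀ p, 0 ≤ s p) (h : ∀ p, IsGevreyLogConvex (s p) (M p)) (hc : CondComega M) :
    CondRai M := by
  refine hM.condRai_of_prod_le hs h fun p => ?_
  obtain ⟨p₀, h0⟩ := hc.exists_seqLE hM
  obtain ⟨D₀, hD₀, h0⟩ := h0.exists_one_le (fun j => (hM.check_pos p₀ j).le)
  obtain ⟨q, hq⟩ := hf (max p p₀)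
  obtain ⟨D, hD, hq⟩ := hq.exists_one_le (fun j => (hM.check_pos q j).le)
  refine ⟨max p p₀, le_max_left _ _, q, D₀ * D, one_le_mul_of_one_le_of_one_le hD₀ hD,
    fun l hl hpos => ?_⟩
  let c : Composition l.sum := ⟨l, fun {i} hi => hpos i hi, rfl⟩
  have hsum : l.sum ≠ 0 := by
    obtain ⟨i, hi⟩ := List.exists_mem_of_ne_nil l hl
    have := List.le_sum_of_mem hi
    have := hpos i hi
    omega
  have h1 := (le_circ (check (M (max p p₀))) hsum c).trans (hq _)
  have h2 : ∏ i : Fin c.length, check (M (max p p₀)) (c.blocksFun i) =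
      (l.map (check (M (max p p₀)))).prod := by
    have hb := congrArg (fun t => (t.map (check (M (max p p₀)))).prod)
      (show List.ofFn c.blocksFun = l from c.ofFn_blocksFun)
    rwa [List.map_ofFn, List.prod_ofFn] at hb
  rw [h2] at h1
  have hP : 0 ≤ (l.map (check (M (max p p₀)))).prod := by
    rw [← h2]; exact Finset.prod_nonneg fun i _ => (hM.check_pos _ _).le
  have h3 : 1 ≤ D₀ ^ (l.sum + 1) * check (M (max p p₀)) c.length := by
    refine (h0 c.length).trans ?_
    have := hM.check_pos p₀ c.length
    refine mul_le_mul (pow_le_pow_right₀ hD₀ (by have := c.length_le; omega))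
      (hM.check_mono (le_max_right _ _) _) this.le (by positivity)
  calc _ ≤ (D₀ ^ (l.sum + 1) * check (M (max p p₀)) c.length) *
        (l.map (check (M (max p p₀)))).prod := le_mul_of_one_le_left hP h3
    _ = D₀ ^ (l.sum + 1) * (check (M (max p p₀)) c.length *
        (l.map (check (M (max p p₀)))).prod) := by ring
    _ ≤ D₀ ^ (l.sum + 1) * (D ^ (l.sum + 1) * check (M q) l.sum) := by gcongr
    _ = _ := by rw [mul_pow]; ring

/-! ### The matrix `rami M β` -/

theorem rami_spec {M : Idx → ℕ → ℝ} {β : ℝ} {p : Idx}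
    (h : IsGevreyLogConvex (β - 1) (M p)) :
    (∀ j, 0 < rami M β p j) ∧ SeqEquiv (rami M β p) (M p) := by
  obtain ⟨L, hL, h1, h2⟩ := h
  have e : ∀ N : ℕ → ℝ, (fun j => gevreyBar (β - 1) j * (gevreyBar (1 - β) j * N j)) = N := by
    intro N; funext j
    rw [← mul_assoc, gevreyBar_mul, show β - 1 + (1 - β) = 0 by ring]
    simp [gevreyBar]
  have e' : ∀ N : ℕ → ℝ, (fun j => gevreyBar (1 - β) j * (gevreyBar (β - 1) j * N j)) = N := by
    intro N; funext j
    rw [← mul_assoc, gevreyBar_mul, show 1 - β + (β - 1) = 0 by ring]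
    simp [gevreyBar]
  have h1 := h1.mul_left (fun j => (gevreyBar_pos (1 - β) j).le)
  have h2 := h2.mul_left (fun j => (gevreyBar_pos (1 - β) j).le)
  rw [e'] at h1 h2
  obtain ⟨hpos, h3, h4⟩ := lcMinorant_spec hL ⟨h1, h2⟩
  have h3 := h3.mul_left (fun j => (gevreyBar_pos (β - 1) j).le)
  have h4 := h4.mul_left (fun j => (gevreyBar_pos (β - 1) j).le)
  rw [e] at h3 h4
  exact ⟨fun j => mul_pos (gevreyBar_pos _ _) (hpos j), h3, h4⟩

/-! ### Derivatives on the surface and Taylor coefficients -/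

theorem isOpen_sector (α : ℝ) : IsOpen (sector α) :=
  isOpen_lt (by fun_prop) continuous_const

theorem differentiableOn_surfaceDeriv {S : Set LogSurface} (hS : IsOpen S) {f : LogSurface → ℂ}
    (hf : DifferentiableOn ℂ f S) : DifferentiableOn ℂ (surfaceDeriv f) S :=
  DifferentiableOn.mul (by fun_prop) (hf.deriv hS)

theorem differentiableOn_iterate_surfaceDeriv {S : Set LogSurface} (hS : IsOpen S)
    {f : LogSurface → ℂ} (hf : DifferentiableOn ℂ f S) (j : ℕ) :
    DifferentiableOn ℂ (surfaceDeriv^[j] f) S := by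
  induction j with
  | zero => exact hf
  | succ j ih => rw [Function.iterate_succ_apply']; exact differentiableOn_surfaceDeriv hS ih

/-- The local inverse at `exp w` of the projection `exp` from the surface to the plane which takes
the value `w` at `exp w`. -/
noncomputable def branch (w : LogSurface) (ζ : ℂ) : LogSurface :=
  w + Complex.log (ζ * Complex.exp (-w))

theorem exp_mul_exp_neg (w : ℂ) : Complex.exp w * Complex.exp (-w) = 1 := by
  rw [← Complex.exp_add, add_neg_cancel, Complex.exp_zero]

theorem branch_exp (w : LogSurface) : branch w (Complex.exp w) = w := by
  simp [branch, exp_mul_exp_neg]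

theorem hasDerivAt_branch {w ζ : ℂ} (h : ζ * Complex.exp (-w) ∈ Complex.slitPlane) :
    HasDerivAt (branch w) (Complex.exp (-branch w ζ)) ζ := by
  have h0 : ζ * Complex.exp (-w) ≠ 0 := Complex.slitPlane_ne_zero h
  have h1 := (((hasDerivAt_id ζ).mul_const (Complex.exp (-w))).clog h).const_add w
  refine h1.congr_deriv ?_
  rw [branch, neg_add, Complex.exp_add, Complex.exp_neg (Complex.log _), Complex.exp_log h0, one_mul]
  rfl

theorem eventually_slitPlane (w : ℂ) :
    ∀ᶠ ζ in 𝓝 (Complex.exp w), ζ * Complex.exp (-w) ∈ Complex.slitPlane := by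
  have hc : ContinuousAt (fun ζ : ℂ => ζ * Complex.exp (-w)) (Complex.exp w) := by fun_prop
  exact hc.eventually_mem (Complex.isOpen_slitPlane.mem_nhds (by
    rw [exp_mul_exp_neg]; exact Complex.one_mem_slitPlane))

theorem eventually_branch_mem {S : Set LogSurface} (hS : IsOpen S) {w : LogSurface} (hw : w ∈ S) :
    ∀ᶠ ζ in 𝓝 (Complex.exp w), branch w ζ ∈ S := by
  have hc : ContinuousAt (branch w) (Complex.exp w) :=
    (hasDerivAt_branch (eventually_slitPlane w).self_of_nhds).continuousAt
  exact hc.eventually_mem (hS.mem_nhds (by rwa [branch_exp]))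

theorem eventually_iteratedDeriv_comp_branch {S : Set LogSurface} (hS : IsOpen S)
    {f : LogSurface → ℂ} (hf : DifferentiableOn ℂ f S) {w : LogSurface} (hw : w ∈ S) (j : ℕ) :
    ∀ᶠ ζ in 𝓝 (Complex.exp w),
      iteratedDeriv j (fun ζ => f (branch w ζ)) ζ = surfaceDeriv^[j] f (branch w ζ) := by
  induction j with
  | zero => simp
  | succ j ih =>
    filter_upwards [ih.eventually_nhds, eventually_slitPlane w, eventually_branch_mem hS hw]
      with ζ h1 h2 h3
    rw [iteratedDeriv_succ, EventuallyEq.deriv_eq h1, Function.iterate_succ_apply', surfaceDeriv]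
    have hd := ((differentiableOn_iterate_surfaceDeriv hS hf j).differentiableAt
      (hS.mem_nhds h3)).hasDerivAt
    rw [mul_comm]
    exact (hd.comp ζ (hasDerivAt_branch h2)).deriv

theorem iteratedDeriv_comp_branch {S : Set LogSurface} (hS : IsOpen S)
    {f : LogSurface → ℂ} (hf : DifferentiableOn ℂ f S) {w : LogSurface} (hw : w ∈ S) (j : ℕ) :
    iteratedDeriv j (fun ζ => f (branch w ζ)) (Complex.exp w) = surfaceDeriv^[j] f w := by
  have := (eventually_iteratedDeriv_comp_branch hS hf hw j).self_of_nhds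
  rwa [branch_exp] at this

theorem analyticAt_comp_branch {S : Set LogSurface} (hS : IsOpen S)
    {f : LogSurface → ℂ} (hf : DifferentiableOn ℂ f S) {w : LogSurface} (hw : w ∈ S) :
    AnalyticAt ℂ (fun ζ => f (branch w ζ)) (Complex.exp w) := by
  rw [Complex.analyticAt_iff_eventually_differentiableAt]
  filter_upwards [eventually_slitPlane w, eventually_branch_mem hS hw] with ζ h2 h3
  exact (hf.differentiableAt (hS.mem_nhds h3)).comp ζ (hasDerivAt_branch h2).differentiableAt

/-- The Faà di Bruno formula in the form of an estimate: bounds on the Taylor coefficients of `g`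
and `f` give a bound on those of `g ∘ f`. -/
theorem norm_iteratedDeriv_comp_le {g f : ℂ → ℂ} {x : ℂ} (hf : AnalyticAt ℂ f x)
    (hg : AnalyticAt ℂ g (f x)) {a b : ℕ → ℝ}
    (ha : ∀ j, 1 ≤ j → ‖iteratedDeriv j f x‖ ≤ j.factorial * a j)
    (hb : ∀ j, ‖iteratedDeriv j g (f x)‖ ≤ j.factorial * b j) (k : ℕ) :
    ‖iteratedDeriv k (g ∘ f) x‖ ≤
      k.factorial * ∑ c : Composition k, b c.length * ∏ i : Fin c.length, a (c.blocksFun i) := by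
  have hco : ∀ (h : ℂ → ℂ) (y : ℂ) (n : ℕ),
      ‖FormalMultilinearSeries.ofScalars ℂ (fun n => iteratedDeriv n h y / n.factorial) n‖ =
        ‖iteratedDeriv n h y‖ / n.factorial := fun h y n => by
    rw [FormalMultilinearSeries.ofScalars_norm, norm_div, Complex.norm_natCast]
  have h1 := hg.hasFPowerSeriesAt.comp hf.hasFPowerSeriesAt
  have h2 := (hg.comp hf).hasFPowerSeriesAt
  have h3 := congrArg (fun p => ‖p k‖) (h2.eq_formalMultilinearSeries h1)
  simp only [hco] at h3
  rw [div_eq_iff (by positivity)] at h3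
  rw [h3, mul_comm]
  gcongr
  refine (norm_sum_le _ _).trans (Finset.sum_le_sum fun c _ => ?_)
  refine (FormalMultilinearSeries.compAlongComposition_norm _ _ c).trans ?_
  have hb' : ∀ j, ‖iteratedDeriv j g (f x)‖ / j.factorial ≤ b j := fun j => by
    rw [div_le_iff₀' (by positivity)]; exact hb j
  refine mul_le_mul ?_ (Finset.prod_le_prod (fun i _ => norm_nonneg _) fun i _ => ?_)
    (Finset.prod_nonneg fun i _ => norm_nonneg _) ((by positivity : (0 : ℝ) ≤ _).trans (hb' _))
  · rw [hco]; exact hb' _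
  · rw [hco, div_le_iff₀' (by positivity)]
    exact ha _ (c.one_le_blocksFun i)

theorem sum_composition_le {k : ℕ} {u : Composition k → ℝ} {x : ℝ} (hx : 0 ≤ x)
    (h : ∀ c, u c ≤ x) : ∑ c, u c ≤ 2 ^ k * x := by
  calc ∑ c, u c ≤ Fintype.card (Composition k) • x := Finset.sum_le_card_nsmul _ _ _ fun c _ => h c
    _ ≤ 2 ^ k * x := by
      rw [composition_card, nsmul_eq_mul]
      push_cast
      gcongr
      · norm_num
      · omega

/-! ### Function classes -/

section Classes

variable {S : Set LogSurface} {f : LogSurface → ℂ}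

/-- Estimates of Taylor coefficients with the two constants merged into one. -/
theorem MemSeqClass.exists_bound {N : ℕ → ℝ} (hN : ∀ j, 0 < N j) (hf : MemSeqClass N S f) :
    ∃ D : ℝ, 1 ≤ D ∧ ∀ z ∈ S, ∀ j, ‖surfaceDeriv^[j] f z‖ ≤ D ^ (j + 1) * N j := by
  obtain ⟨-, h, hh, C, hC⟩ := hf
  refine ⟨max 1 (max C h), le_max_left _ _, fun z hz j => (hC z hz j).trans ?_⟩
  have h1 : C ≤ max 1 (max C h) := le_max_of_le_right (le_max_left _ _)
  have h2 : h ≤ max 1 (max C h) := le_max_of_le_right (le_max_right _ _)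
  have := hN j
  rw [pow_succ', ← mul_assoc]
  gcongr

theorem memSeqClass_of_bound {N : ℕ → ℝ} (hf : DifferentiableOn ℂ f S) {D : ℝ} (hD : 0 < D)
    (h : ∀ z ∈ S, ∀ j, ‖surfaceDeriv^[j] f z‖ ≤ D ^ (j + 1) * N j) : MemSeqClass N S f :=
  ⟨hf, D, hD, D, fun z hz j => (h z hz j).trans_eq (by ring)⟩

theorem MemSeqClass.isCompact_closure {N : ℕ → ℝ} (hf : MemSeqClass N S f) :
    IsCompact (closure (f '' S)) := by
  obtain ⟨-, h, -, C, hC⟩ := hf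
  have hsub : f '' S ⊆ Metric.closedBall 0 (C * (h ^ 0 * N 0)) := by
    rintro _ ⟨z, hz, rfl⟩
    simpa using hC z hz 0
  exact (Metric.isBounded_closedBall.subset hsub).isCompact_closure

theorem exists_cauchy_estimate {K U : Set ℂ} (hK : IsCompact K) (hU : IsOpen U) (hKU : K ⊆ U)
    {g : ℂ → ℂ} (hg : DifferentiableOn ℂ g U) :
    ∃ D : ℝ, 1 ≤ D ∧ ∀ z ∈ K, ∀ j : ℕ, ‖iteratedDeriv j g z‖ ≤ D ^ (j + 1) * j.factorial := by
  obtain ⟨δ, hδ, hδU⟩ := hK.exists_cthickening_subset_open hU hKU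
  obtain ⟨C, hC⟩ := hK.cthickening.exists_bound_of_continuousOn (hg.continuousOn.mono hδU)
  have hD1 : (1 : ℝ) ≤ max 1 (max C δ⁻¹) := le_max_left _ _
  refine ⟨max 1 (max C δ⁻¹), hD1, fun z hz j => ?_⟩
  have hball : Metric.closedBall z δ ⊆ Metric.cthickening δ K :=
    Metric.closedBall_subset_cthickening hz δ
  have hd : DiffContOnCl ℂ g (Metric.ball z δ) :=
    (hg.mono (Metric.closure_ball_subset_closedBall.trans (hball.trans hδU))).diffContOnCl
  refine (Complex.norm_iteratedDeriv_le_of_forall_mem_sphere_norm_le j hδ hd fun w hw =>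
    hC w (hball (Metric.sphere_subset_closedBall hw))).trans ?_
  have h1 : C ≤ max 1 (max C δ⁻¹) := le_max_of_le_right (le_max_left _ _)
  have h2 : δ⁻¹ ≤ max 1 (max C δ⁻¹) := le_max_of_le_right (le_max_right _ _)
  calc j.factorial * C / δ ^ j = C * δ⁻¹ ^ j * j.factorial := by rw [inv_pow]; ring
    _ ≤ _ := by rw [pow_succ']; gcongr

/-- Membership of `g ∘ f` in a class, from an estimate of the terms of the
Faà di Bruno formula. -/
theorem memSeqClass_comp (hS : IsOpen S) (hf : DifferentiableOn ℂ f S) {U : Set ℂ}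
    (hU : IsOpen U) (hfU : f '' S ⊆ U) {g : ℂ → ℂ} (hg : DifferentiableOn ℂ g U)
    {Q a b : ℕ → ℝ} (hQ : ∀ j, 0 < Q j)
    (ha : ∀ z ∈ S, ∀ j, ‖surfaceDeriv^[j] f z‖ ≤ j.factorial * a j)
    (hb : ∀ z ∈ S, ∀ j, ‖iteratedDeriv j g (f z)‖ ≤ j.factorial * b j) {D : ℝ} (hD : 1 ≤ D)
    (hab : ∀ (k : ℕ) (c : Composition k), b c.length * ∏ i : Fin c.length, a (c.blocksFun i) ≤
      D ^ (k + 1) * check Q k) :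
    MemSeqClass Q S (fun z => g (f z)) := by
  have hgf : DifferentiableOn ℂ (fun z => g (f z)) S :=
    hg.comp hf (Set.mapsTo_iff_image_subset.2 hfU)
  refine memSeqClass_of_bound hgf (D := 2 * D) (by positivity) fun z hz k => ?_
  have hz' : f z ∈ U := hfU ⟨z, hz, rfl⟩
  rw [← iteratedDeriv_comp_branch hS hgf hz]
  have hfa := analyticAt_comp_branch hS hf hz
  have hga : AnalyticAt ℂ g (f (branch z (Complex.exp z))) := by
    rw [branch_exp]; exact hg.analyticAt (hU.mem_nhds hz')
  have h := norm_iteratedDeriv_comp_le hfa hga (a := a) (b := b)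
    (fun j _ => by rw [iteratedDeriv_comp_branch hS hf hz]; exact ha z hz j)
    (fun j => by rw [branch_exp]; exact hb z hz j) k
  refine h.trans ?_
  have hq := check_pos hQ k
  calc _ ≤ (k.factorial : ℝ) * (2 ^ k * (D ^ (k + 1) * check Q k)) := by
        gcongr
        exact sum_composition_le (by positivity) (hab k)
    _ = 2 ^ k * (D ^ (k + 1) * Q k) := by unfold check; field_simp
    _ ≤ 2 ^ (k + 1) * (D ^ (k + 1) * Q k) := by
        have := hQ k
        gcongr
        · norm_num
        · omega
    _ = _ := by rw [mul_pow]; ring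

end Classes

section Closed

variable {M : Idx → ℕ → ℝ} (hM : IsWeightMatrix M) {S : Set LogSurface}

include hM

theorem CondRai.holomorphicallyClosed (hS : IsOpen S) (hr : CondRai M) :
    HolomorphicallyClosed M S := by
  intro f ⟨p, hf⟩ U hU hfU g hg
  obtain ⟨D₁, hD₁, h1⟩ := hf.exists_bound (hM.pos p)
  obtain ⟨D₂, hD₂, h2⟩ := exists_cauchy_estimate hf.isCompact_closure hU hfU hg
  obtain ⟨C, hC, q, hq⟩ := hr.exists_prod_le hM p
  refine ⟨q, memSeqClass_comp hS hf.1 hU (subset_closure.trans hfU) hg (hM.pos q)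
    (a := fun j => D₁ ^ (j + 1) * check (M p) j) (b := fun j => D₂ ^ (j + 1))
    (fun z hz j => (h1 z hz j).trans_eq (by unfold check; field_simp))
    (fun z hz j => (h2 _ (subset_closure ⟨z, hz, rfl⟩) j).trans_eq (by ring))
    (D := D₂ * (D₁ * D₁) * C) ?_ fun k c => ?_⟩
  · exact one_le_mul_of_one_le_of_one_le
      (one_le_mul_of_one_le_of_one_le hD₂ (one_le_mul_of_one_le_of_one_le hD₁ hD₁)) hC
  have hl := c.length_le
  have hqk := hM.check_pos q k
  simp only [pow_succ D₁]
  rw [Finset.prod_mul_distrib, Finset.prod_mul_distrib, prod_pow_blocksFun]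
  simp only [Finset.prod_const, Finset.card_univ, Fintype.card_fin]
  calc D₂ ^ (c.length + 1) * (D₁ ^ k * D₁ ^ c.length *
        ∏ i : Fin c.length, check (M p) (c.blocksFun i))
      ≤ D₂ ^ (k + 1) * (D₁ ^ (k + 1) * D₁ ^ (k + 1) * (C ^ (k + 1) * check (M q) k)) := by
        have hP : 0 ≤ ∏ i : Fin c.length, check (M p) (c.blocksFun i) :=
          Finset.prod_nonneg fun i _ => (hM.check_pos p _).le
        have hPC := (hq k c).trans (mul_le_mul_of_nonneg_right
          (pow_le_pow_right₀ hC (Nat.le_succ k)) hqk.le)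
        gcongr <;> first | assumption | omega
    _ = _ := by rw [mul_pow, mul_pow, mul_pow D₁]; ring

theorem CondFdB.compositionClosed (hS : IsOpen S) (hr : CondFdB M) : CompositionClosed M S := by
  intro f ⟨p, hf⟩ U hU hfU g ⟨hg, hgK⟩
  obtain ⟨D₁, hD₁, h1⟩ := hf.exists_bound (hM.pos p)
  obtain ⟨p', h, hh, C, h2⟩ := hgK _ hf.isCompact_closure hfU
  obtain ⟨D₂, hD₂, h2'⟩ : ∃ D₂ : ℝ, 1 ≤ D₂ ∧ ∀ z ∈ closure (f '' S), ∀ j : ℕ,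
      ‖iteratedDeriv j g z‖ ≤ D₂ ^ (j + 1) * M p' j := by
    refine ⟨max 1 (max C h), le_max_left _ _, fun z hz j => (h2 z hz j).trans ?_⟩
    have h1 : C ≤ max 1 (max C h) := le_max_of_le_right (le_max_left _ _)
    have h2 : h ≤ max 1 (max C h) := le_max_of_le_right (le_max_right _ _)
    have := hM.pos p' j
    rw [pow_succ', ← mul_assoc]
    gcongr
  set r := max p p' with hr'
  obtain ⟨q, hq⟩ := hr r
  obtain ⟨D, hD, hq⟩ := hq.exists_one_le (fun j => (hM.check_pos q j).le)
  refine ⟨q, memSeqClass_comp hS hf.1 hU (subset_closure.trans hfU) hg (hM.pos q)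
    (a := fun j => D₁ ^ (j + 1) * check (M r) j) (b := fun j => D₂ ^ (j + 1) * check (M r) j)
    (fun z hz j => (h1 z hz j).trans ?_)
    (fun z hz j => (h2' _ (subset_closure ⟨z, hz, rfl⟩) j).trans ?_)
    (D := D₂ * (D₁ * D₁) * D) ?_ fun k c => ?_⟩
  · unfold check
    have := hM.mono p r (le_max_left _ _) j
    calc D₁ ^ (j + 1) * M p j ≤ D₁ ^ (j + 1) * M r j := by gcongr
      _ = _ := by field_simp
  · unfold check
    have := hM.mono p' r (le_max_right _ _) j
    calc D₂ ^ (j + 1) * M p' j ≤ D₂ ^ (j + 1) * M r j := by gcongr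
      _ = _ := by field_simp
  · exact one_le_mul_of_one_le_of_one_le
      (one_le_mul_of_one_le_of_one_le hD₂ (one_le_mul_of_one_le_of_one_le hD₁ hD₁)) hD
  have hl := c.length_le
  have hqk := hM.check_pos q k
  simp only [pow_succ D₁]
  rw [Finset.prod_mul_distrib, Finset.prod_mul_distrib, prod_pow_blocksFun]
  simp only [Finset.prod_const, Finset.card_univ, Fintype.card_fin]
  have hP : 0 ≤ ∏ i : Fin c.length, check (M r) (c.blocksFun i) :=
    Finset.prod_nonneg fun i _ => (hM.check_pos r _).le
  have hPl := (hM.check_pos r c.length).le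
  have hle : check (M r) c.length * ∏ i : Fin c.length, check (M r) (c.blocksFun i) ≤
      D ^ (k + 1) * check (M q) k := by
    rcases eq_or_ne k 0 with rfl | hk
    · have h0 : c.length = 0 := by omega
      have : IsEmpty (Fin c.length) := by rw [h0]; infer_instance
      have h1 : check (M r) c.length = 1 := by rw [h0, hM.check_zero]
      rw [h1, hM.check_zero]
      simpa using hD
    · exact (le_circ _ hk c).trans (hq k)
  calc D₂ ^ (c.length + 1) * check (M r) c.length * (D₁ ^ k * D₁ ^ c.length *
        ∏ i : Fin c.length, check (M r) (c.blocksFun i))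
      = D₂ ^ (c.length + 1) * (D₁ ^ k * D₁ ^ c.length *
        (check (M r) c.length * ∏ i : Fin c.length, check (M r) (c.blocksFun i))) := by ring
    _ ≤ D₂ ^ (k + 1) * (D₁ ^ (k + 1) * D₁ ^ (k + 1) * (D ^ (k + 1) * check (M q) k)) := by
        have := mul_nonneg hPl hP
        gcongr <;> first | assumption | omega
    _ = _ := by rw [mul_pow, mul_pow, mul_pow D₁]; ring

/-- Under `(M_{C^ω})`, Cauchy estimates put every holomorphic function into the plane class. -/
theorem CompositionClosed.holomorphicallyClosed (hd : CompositionClosed M S) (hc : CondComega M) :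
    HolomorphicallyClosed M S := by
  intro f hf U hU hfU g hg
  refine hd f hf U hU hfU g ⟨hg, fun K hK hKU => ?_⟩
  obtain ⟨p, hp⟩ := hc.exists_seqLE hM
  obtain ⟨D, hD, hp⟩ := hp.exists_one_le (fun j => (hM.check_pos p j).le)
  obtain ⟨D', hD', h⟩ := exists_cauchy_estimate hK hU hKU hg
  refine ⟨p, D' * D, by positivity, D' * D, fun z hz j => (h z hz j).trans ?_⟩
  calc D' ^ (j + 1) * j.factorial ≤ D' ^ (j + 1) * j.factorial * (D ^ (j + 1) * check (M p) j) :=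
        le_mul_of_one_le_right (by positivity) (hp j)
    _ = _ := by unfold check; rw [mul_pow, pow_succ, pow_succ]; field_simp

end Closed

theorem HolomorphicallyClosed.inverseClosed {M : Idx → ℕ → ℝ} {S : Set LogSurface}
    (h : HolomorphicallyClosed M S) : InverseClosed M S := by
  rintro f hf ⟨c, hc, hcf⟩
  refine h f hf {0}ᶜ isOpen_compl_singleton ?_ (fun w => 1 / w) ?_
  · have : closure (f '' S) ⊆ {w | c ≤ ‖w‖} :=
      closure_minimal (by rintro _ ⟨z, hz, rfl⟩; exact hcf z hz)
        (isClosed_le continuous_const continuous_norm)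
    rintro w hw (rfl : w = 0)
    have := this hw
    simp only [Set.mem_ofPred_eq, norm_zero] at this
    linarith
  · intro w hw
    have hw0 : w ≠ 0 := hw
    exact ((differentiableAt_const _).div differentiableAt_id hw0).differentiableWithinAt

/-! ### An integral with optimal Gevrey estimates on a sector -/

/-- This is convergence of the integral for the Gamma function, with `u = exp v`. -/
theorem integrable_exp_neg_exp {c b : ℝ} (hc : 0 < c) (hb : 0 < b) :
    Integrable (fun v : ℝ => Real.exp (-c * Real.exp v + b * v)) := by
  have h := integrableOn_rpow_mul_exp_neg_mul_rpow (s := b - 1) (p := 1) (b := c)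
    (by linarith) one_pos hc
  rw [← Real.range_exp, ← Set.image_univ, integrableOn_image_iff_integrableOn_abs_deriv_smul
    MeasurableSet.univ (fun x _ => (Real.hasDerivAt_exp x).hasDerivWithinAt)
    Real.exp_injective.injOn, integrableOn_univ] at h
  refine h.congr (Eventually.of_forall fun v => ?_)
  simp only [smul_eq_mul, Real.abs_exp, Real.rpow_one]
  rw [← Real.exp_mul, ← Real.exp_add, ← Real.exp_add]
  congr 1; ring

/-- With `u = exp v`, this bounds the maximum of `exp (-c u) * u ^ (j s)` over `u > 0`. -/
theorem exp_neg_exp_add_le {c : ℝ} (hc : 0 < c) {s : ℝ} (hs : 0 < s) (j : ℕ) (v : ℝ) :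
    Real.exp (-c * Real.exp v + j * s * v) ≤ ((s / c) ^ s) ^ j * gevreyBar s j := by
  rcases Nat.eq_zero_or_pos j with rfl | hj
  · simp only [Nat.cast_zero, zero_mul, add_zero, pow_zero, gevreyBar_zero, mul_one,
      Real.exp_le_one_iff]
    have := Real.exp_pos v
    nlinarith
  · have hj' : (0 : ℝ) < j := by exact_mod_cast hj
    have ha : 0 < j * s := by positivity
    have h1 : ((s / c) ^ s) ^ j * gevreyBar s j = Real.exp (j * s * Real.log (j * s / c)) := by
      rw [gevreyBar, ← Real.rpow_natCast, ← Real.rpow_mul (by positivity), mul_comm s,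
        ← Real.mul_rpow (by positivity) (by positivity), Real.rpow_def_of_pos (by positivity),
        mul_comm, div_mul_eq_mul_div, mul_comm s]
    rw [h1, Real.exp_le_exp]
    -- with `t = c * exp v / (j * s)`, this is `log t ≤ t - 1`
    have h2 := Real.log_le_sub_one_of_pos (x := c * Real.exp v / (j * s)) (by positivity)
    rw [Real.log_div (by positivity) ha.ne', Real.log_mul hc.ne' (Real.exp_pos v).ne',
      Real.log_exp] at h2
    rw [Real.log_div ha.ne' hc.ne']
    have h3 := mul_le_mul_of_nonneg_left h2 ha.le
    rw [mul_sub, mul_add, mul_sub, mul_div_cancel₀ _ ha.ne', mul_one] at h3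
    rw [mul_sub]
    linarith

/-- The integrand `exp (-z u ^ s - u) u ^ b du / u` after the substitution
`z = exp w`, `u = exp (v - w / (1 + s))`. This shift of `v` by a complex quantity
depending on `w` distributes the argument of `z` evenly between `z u ^ s` and `u`, and makes the
integral over `v ∈ ℝ` converge for `|arg z| < (1 + s) π / 2`. -/
noncomputable def ker (s b : ℝ) (w : ℂ) (v : ℝ) : ℂ :=
  Complex.exp (-Complex.exp (((1 + s)⁻¹ : ℝ) * w + (s : ℂ) * v)
    - Complex.exp (v - ((1 + s)⁻¹ : ℝ) * w) + b * (v - ((1 + s)⁻¹ : ℝ) * w))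

/-- The integral of `exp (-z u ^ s - u) u ^ (b - 1)` over `u > 0`, continued analytically to
`|arg z| < (1 + s) π / 2`, with `z = exp w`. -/
noncomputable def kerInt (s b : ℝ) (w : ℂ) : ℂ := ∫ v : ℝ, ker s b w v

/-- The cosine of the common argument, up to sign, of `z u ^ s` and `u` on the shifted path of
integration. Its positivity makes the integral defining `kerInt` converge. -/
noncomputable def angleCos (s : ℝ) (w : ℂ) : ℝ := Real.cos ((1 + s)⁻¹ * w.im)

section Kernel

variable {s : ℝ}

theorem norm_ker (s b : ℝ) (w : ℂ) (v : ℝ) :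
    ‖ker s b w v‖ = Real.exp (-(Real.exp ((1 + s)⁻¹ * w.re + s * v) * angleCos s w)
      - Real.exp (v - (1 + s)⁻¹ * w.re) * angleCos s w + b * (v - (1 + s)⁻¹ * w.re)) := by
  rw [ker, Complex.norm_exp]
  congr 1
  simp only [Complex.add_re, Complex.sub_re, Complex.neg_re, Complex.exp_re, Complex.mul_re,
    Complex.ofReal_re, Complex.ofReal_im, Complex.add_im, Complex.mul_im, Complex.sub_im, angleCos,
    zero_mul, mul_zero, sub_zero, add_zero, zero_sub, Real.cos_neg]

theorem norm_ker_le {b c : ℝ} {w : ℂ} (hc : c ≤ angleCos s w) (hw : 0 < angleCos s w) (v : ℝ) :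
    ‖ker s b w v‖ ≤ Real.exp (-c * Real.exp (v - (1 + s)⁻¹ * w.re)
      + b * (v - (1 + s)⁻¹ * w.re)) := by
  rw [norm_ker, Real.exp_le_exp]
  have h1 := mul_nonneg (Real.exp_pos ((1 + s)⁻¹ * w.re + s * v)).le hw.le
  have h2 := mul_le_mul_of_nonneg_left hc (Real.exp_pos (v - (1 + s)⁻¹ * w.re)).le
  linarith

theorem continuous_ker (s b : ℝ) (w : ℂ) : Continuous (ker s b w) := by
  unfold ker; fun_prop

theorem integrable_ker {b : ℝ} (hb : 0 < b) {w : ℂ} (hw : 0 < angleCos s w) :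
    Integrable (ker s b w) :=
  ((integrable_exp_neg_exp hw hb).comp_sub_right ((1 + s)⁻¹ * w.re)).mono'
    (continuous_ker s b w).aestronglyMeasurable
    (Eventually.of_forall (norm_ker_le le_rfl hw))

theorem norm_kerInt_le {b c : ℝ} (hb : 0 < b) (hc : 0 < c) {w : ℂ} (hw : c ≤ angleCos s w) :
    ‖kerInt s b w‖ ≤ ∫ v : ℝ, Real.exp (-c * Real.exp v + b * v) := by
  rw [← integral_sub_right_eq_self _ ((1 + s)⁻¹ * w.re)]
  exact norm_integral_le_of_norm_le ((integrable_exp_neg_exp hc hb).comp_sub_right _)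
    (Eventually.of_forall (norm_ker_le hw (hc.trans_le hw)))

theorem ker_add_one (s b : ℝ) (w : ℂ) (v : ℝ) :
    Complex.exp (v - ((1 + s)⁻¹ : ℝ) * w) * ker s b w v = ker s (b + 1) w v := by
  rw [ker, ker, ← Complex.exp_add]
  congr 1; push_cast; ring

theorem ker_add_self (hs : 0 < s) (b : ℝ) (w : ℂ) (v : ℝ) :
    Complex.exp (((1 + s)⁻¹ : ℝ) * w + (s : ℂ) * v) * ker s b w v =
      Complex.exp w * ker s (b + s) w v := by
  have h : ((1 + s)⁻¹ : ℝ) * w + (s : ℂ) * v = w + s * (v - ((1 + s)⁻¹ : ℝ) * w) := by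
    have : (1 + s : ℂ) ≠ 0 := by exact_mod_cast (by positivity : (1 + s : ℝ) ≠ 0)
    push_cast
    field_simp
    ring
  rw [ker, ker, ← Complex.exp_add, ← Complex.exp_add]
  congr 1
  nth_rewrite 1 [h]
  push_cast; ring

theorem hasDerivAt_ker (hs : 0 < s) (b : ℝ) (w : ℂ) (v : ℝ) :
    HasDerivAt (fun w => ker s b w v)
      (((1 + s)⁻¹ : ℝ) * (-Complex.exp w * ker s (b + s) w v + ker s (b + 1) w v
        - b * ker s b w v)) w := by
  have h1 : HasDerivAt (fun w : ℂ => (((1 + s)⁻¹ : ℝ) : ℂ) * w) (((1 + s)⁻¹ : ℝ) : ℂ) w := by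
    simpa using (hasDerivAt_id w).const_mul (((1 + s)⁻¹ : ℝ) : ℂ)
  have h2 := (h1.add_const ((s : ℂ) * v)).cexp
  have h3 := h1.const_sub (v : ℂ)
  have h4 := ((h2.neg.sub h3.cexp).add (h3.const_mul (b : ℂ))).cexp
  refine h4.congr_deriv ?_
  rw [← ker_add_one, neg_mul, ← ker_add_self hs, ker]
  simp only [Pi.add_apply, Pi.sub_apply, Pi.neg_apply]
  ring

theorem hasDerivAt_ker_right (hs : 0 < s) (b : ℝ) (w : ℂ) (v : ℝ) :
    HasDerivAt (ker s b w)
      (-(s * Complex.exp w) * ker s (b + s) w v - ker s (b + 1) w v + b * ker s b w v) v := by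
  have h1 : HasDerivAt (fun v : ℝ => (v : ℂ)) 1 v := Complex.ofRealCLM.hasDerivAt
  have h2 := ((h1.const_mul (s : ℂ)).const_add ((((1 + s)⁻¹ : ℝ) : ℂ) * w)).cexp
  have h3 := h1.sub_const ((((1 + s)⁻¹ : ℝ) : ℂ) * w)
  have h4 := ((h2.neg.sub h3.cexp).add (h3.const_mul (b : ℂ))).cexp
  refine h4.congr_deriv ?_
  rw [← ker_add_one, neg_mul, mul_assoc, ← ker_add_self hs, ker]
  simp only [Pi.add_apply, Pi.sub_apply, Pi.neg_apply]
  ring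

/-- The integral over the real line of the derivative of `ker s b w` in `v` vanishes. -/
theorem kerInt_identity (hs : 0 < s) {b : ℝ} (hb : 0 < b) {w : ℂ} (hw : 0 < angleCos s w) :
    -(s * Complex.exp w) * kerInt s (b + s) w - kerInt s (b + 1) w + b * kerInt s b w = 0 := by
  have i1 := (integrable_ker (add_pos hb hs) hw).const_mul (-(s * Complex.exp w))
  have i2 := integrable_ker (add_pos hb one_pos) hw
  have i3 := (integrable_ker hb hw).const_mul (b : ℂ)
  have := integral_eq_zero_of_hasDerivAt_of_integrable (hasDerivAt_ker_right hs b w)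
    ((i1.sub i2).add i3) (integrable_ker hb hw)
  have h1 := integral_add (i1.sub i2) i3
  have h2 := integral_sub i1 i2
  simp only [Pi.sub_apply] at h1
  rw [this, h2, integral_const_mul, integral_const_mul] at h1
  exact h1.symm

/-- Differentiation under the integral sign gives three terms, because `w` also enters through the
shift of the path of integration. Two of them are removed by `kerInt_identity`, and what is left is
the derivative of the integrand of the unshifted integral. -/
theorem hasDerivAt_kerInt (hs : 0 < s) {b : ℝ} (hb : 0 < b) {w : ℂ} (hw : 0 < angleCos s w) :
    HasDerivAt (kerInt s b) (-(Complex.exp w * kerInt s (b + s) w)) w := by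
  set κ := (1 + s)⁻¹ with hκ
  have hκ0 : 0 < κ := by positivity
  -- `ker s b z` is dominated on the neighbourhood `|re z| < R`, `c < angleCos s z` of `w`
  set R := |w.re| + 1 with hR
  set c := angleCos s w / 2 with hc
  have hc0 : 0 < c := by positivity
  have hU : {z : ℂ | |z.re| < R ∧ c < angleCos s z} ∈ 𝓝 w := by
    have hre : Continuous fun z : ℂ => |z.re| := by fun_prop
    have han : Continuous (angleCos s) := by unfold angleCos; fun_prop
    have h1 : ∀ᶠ z in 𝓝 w, |z.re| < R :=
      hre.continuousAt.eventually_lt_const (by rw [hR]; linarith)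
    have h2 : ∀ᶠ z in 𝓝 w, c < angleCos s z :=
      han.continuousAt.eventually_const_lt (by rw [hc]; linarith)
    exact h1.and h2
  let g : ℝ → ℝ → ℝ := fun b v =>
    Real.exp (b * (κ * R)) * Real.exp (-(c * Real.exp (-(κ * R))) * Real.exp v + b * v)
  have hg : ∀ {b : ℝ}, 0 < b → Integrable (g b) := fun hb =>
    (integrable_exp_neg_exp (by positivity) hb).const_mul _
  have hle : ∀ {b : ℝ}, 0 < b → ∀ (v : ℝ) (z : ℂ), |z.re| < R ∧ c < angleCos s z →
      ‖ker s b z v‖ ≤ g b v := by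
    intro b hb v z ⟨hz1, hz2⟩
    refine (norm_ker_le hz2.le (hc0.trans hz2) v).trans ?_
    simp only [g]
    rw [← Real.exp_add, Real.exp_le_exp, ← hκ]
    obtain ⟨h1, h2⟩ := abs_lt.1 hz1
    have h3 : κ * z.re ≤ κ * R := by gcongr
    have h4 : -(κ * z.re) ≤ κ * R := by
      have := mul_le_mul_of_nonneg_left h1.le hκ0.le
      linarith
    have h5 : Real.exp (-(κ * R)) * Real.exp v ≤ Real.exp (v - κ * z.re) := by
      rw [← Real.exp_add, Real.exp_le_exp]; linarith
    have h6 := mul_le_mul_of_nonneg_left h5 hc0.le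
    have h7 := mul_le_mul_of_nonneg_left h4 hb.le
    nlinarith
  have key := hasDerivAt_integral_of_dominated_loc_of_deriv_le (μ := (volume : Measure ℝ))
    (F := ker s b) (x₀ := w)
    (F' := fun z v => (κ : ℂ) * (-Complex.exp z * ker s (b + s) z v + ker s (b + 1) z v
        - b * ker s b z v))
    (bound := fun v => κ * (Real.exp R * g (b + s) v + g (b + 1) v + b * g b v)) hU
    (Eventually.of_forall fun z => (continuous_ker s b z).aestronglyMeasurable)
    (integrable_ker hb hw)
    (by
      have := continuous_ker s b w
      have := continuous_ker s (b + s) w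
      have := continuous_ker s (b + 1) w
      exact Continuous.aestronglyMeasurable (by fun_prop))
    (Eventually.of_forall fun v z hz => by
      rw [norm_mul, Complex.norm_real, Real.norm_of_nonneg hκ0.le]
      gcongr
      refine (norm_sub_le _ _).trans (add_le_add ((norm_add_le _ _).trans (add_le_add ?_ ?_)) ?_)
      · rw [norm_mul, norm_neg, Complex.norm_exp]
        have : Real.exp z.re ≤ Real.exp R := Real.exp_le_exp.2 ((le_abs_self _).trans hz.1.le)
        gcongr
        exact hle (add_pos hb hs) v z hz
      · exact hle (add_pos hb one_pos) v z hz
      · rw [norm_mul, Complex.norm_real, Real.norm_of_nonneg hb.le]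
        gcongr
        exact hle hb v z hz)
    ((((hg (add_pos hb hs)).const_mul _).add (hg (add_pos hb one_pos))).add
      ((hg hb).const_mul _) |>.const_mul _)
    (Eventually.of_forall fun v z _ => hasDerivAt_ker hs b z v)
  refine key.2.congr_deriv ?_
  have i1 := (integrable_ker (add_pos hb hs) hw).const_mul (-Complex.exp w)
  have i2 := integrable_ker (add_pos hb one_pos) hw
  have i3 := (integrable_ker hb hw).const_mul (b : ℂ)
  have h1 := integral_sub (i1.add i2) i3
  have h2 := integral_add i1 i2
  simp only [Pi.add_apply] at h1
  rw [integral_const_mul, h1, h2, integral_const_mul, integral_const_mul]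
  change (κ : ℂ) * (-Complex.exp w * kerInt s (b + s) w + kerInt s (b + 1) w
    - b * kerInt s b w) = _
  have hid := kerInt_identity hs hb hw
  have hκs : (κ : ℂ) * (1 + s) = 1 := by
    rw [hκ]; exact_mod_cast inv_mul_cancel₀ (by positivity : (1 + s : ℝ) ≠ 0)
  linear_combination (-(κ : ℂ)) * hid - Complex.exp w * kerInt s (b + s) w * hκs

theorem exists_norm_kerInt_le (hs : 0 < s) {c : ℝ} (hc : 0 < c) :
    ∃ D : ℝ, 1 ≤ D ∧ ∀ (j : ℕ) (w : ℂ), c ≤ angleCos s w →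
      ‖kerInt s (j * s + 1) w‖ ≤ D ^ (j + 1) * gevreyBar s j := by
  set A := ∫ v : ℝ, Real.exp (-(c / 2) * Real.exp v + 1 * v) with hA
  set h := (s / (c / 2)) ^ s with hh
  have hh0 : 0 < h := by positivity
  refine ⟨max 1 (max A h), le_max_left _ _, fun j w hw => ?_⟩
  have h1 : A ≤ max 1 (max A h) := le_max_of_le_right (le_max_left _ _)
  have h2 : h ≤ max 1 (max A h) := le_max_of_le_right (le_max_right _ _)
  have hG := gevreyBar_pos s j
  have hc2 : 0 < c / 2 := by positivity
  calc ‖kerInt s (j * s + 1) w‖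
      ≤ ∫ v : ℝ, Real.exp (-c * Real.exp v + (j * s + 1) * v) :=
        norm_kerInt_le (by positivity) hc hw
    _ ≤ ∫ v : ℝ, (h ^ j * gevreyBar s j) * Real.exp (-(c / 2) * Real.exp v + 1 * v) := by
        refine integral_mono (integrable_exp_neg_exp hc (by positivity))
          ((integrable_exp_neg_exp hc2 one_pos).const_mul _) fun v => ?_
        have := exp_neg_exp_add_le hc2 hs j v
        calc Real.exp (-c * Real.exp v + (j * s + 1) * v)
            = Real.exp (-(c / 2) * Real.exp v + j * s * v) *
              Real.exp (-(c / 2) * Real.exp v + 1 * v) := by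
              rw [← Real.exp_add]; congr 1; ring
          _ ≤ _ := by gcongr
    _ = A * h ^ j * gevreyBar s j := by rw [integral_const_mul]; ring
    _ ≤ _ := by
        rw [pow_succ']
        gcongr

/-- The values of `kerInt` at `exp x > 0`. -/
noncomputable def kerIntReal (s b x : ℝ) : ℝ :=
  ∫ v : ℝ, Real.exp (-Real.exp (x + s * v) - Real.exp v + b * v)

/-- On the positive real axis the path of integration is merely translated along the real line. -/
theorem kerInt_ofReal (hs : 0 < s) (b x : ℝ) : kerInt s b x = kerIntReal s b x := by
  have e : ∀ v : ℝ, ker s b x v = ((Real.exp (-Real.exp (x + s * (v - (1 + s)⁻¹ * x))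
      - Real.exp (v - (1 + s)⁻¹ * x) + b * (v - (1 + s)⁻¹ * x)) : ℝ) : ℂ) := fun v => by
    have h : (1 + s)⁻¹ * x + s * v = x + s * (v - (1 + s)⁻¹ * x) := by field_simp; ring
    rw [← h, ker]
    push_cast
    rfl
  rw [kerInt, kerIntReal, integral_congr_ae (Eventually.of_forall e), integral_complex_ofReal]
  exact congrArg _ (integral_sub_right_eq_self
    (fun v => Real.exp (-Real.exp (x + s * v) - Real.exp v + b * v)) _)

theorem kerIntReal_nonneg (s b x : ℝ) : 0 ≤ kerIntReal s b x :=
  integral_nonneg fun _ => (Real.exp_pos _).le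

/-- The lower bound comes from `j ≤ u ≤ e j`, that is `log j ≤ v ≤ log j + 1`; for such `u` the
factor `exp (-z u ^ s)` is at least `exp (-1)` when `z = exp x` is small enough. -/
theorem gevreyBar_le_kerIntReal (hs : 0 < s) {j : ℕ} (hj : 1 ≤ j) {x : ℝ}
    (hx : x ≤ -(s * (Real.log j + 1))) :
    Real.exp (-1 - Real.exp 1 * j) * gevreyBar s j ≤ kerIntReal s (j * s + 1) x := by
  have hj' : (1 : ℝ) ≤ j := by exact_mod_cast hj
  have hlog : 0 ≤ Real.log j := Real.log_nonneg hj'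
  set a := Real.log j with ha
  set C := Real.exp (-1 - Real.exp 1 * j) * gevreyBar s j with hC
  have hint : Integrable (fun v : ℝ =>
      Real.exp (-Real.exp (x + s * v) - Real.exp v + (j * s + 1) * v)) := by
    refine (integrable_exp_neg_exp one_pos (b := j * s + 1) (by positivity)).mono'
      (Continuous.aestronglyMeasurable (by fun_prop)) (Eventually.of_forall fun v => ?_)
    rw [Real.norm_of_nonneg (Real.exp_pos _).le, Real.exp_le_exp]
    have := Real.exp_pos (x + s * v)
    linarith
  have hI : ∫ v : ℝ, (Set.Icc a (a + 1)).indicator (fun _ => C) v = C := by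
    rw [integral_indicator measurableSet_Icc, setIntegral_const]
    simp
  rw [← hI]
  refine integral_mono ((integrable_indicator_iff measurableSet_Icc).2
    (integrableOn_const (by simp))) hint fun v => ?_
  by_cases hv : v ∈ Set.Icc a (a + 1)
  · rw [Set.indicator_of_mem hv, hC, gevreyBar_eq_exp, ← Real.exp_add, Real.exp_le_exp]
    have h1 : Real.exp (x + s * v) ≤ 1 := by
      rw [Real.exp_le_one_iff]
      have := mul_le_mul_of_nonneg_left hv.2 hs.le
      linarith
    have h2 : Real.exp v ≤ Real.exp 1 * j := by
      calc Real.exp v ≤ Real.exp (a + 1) := Real.exp_le_exp.2 hv.2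
        _ = Real.exp 1 * j := by rw [Real.exp_add, ha, Real.exp_log (by linarith), mul_comm]
    have h3 : s * (j * a) ≤ (j * s + 1) * v := by
      have : (j * s) * a ≤ (j * s) * v := mul_le_mul_of_nonneg_left hv.1 (by positivity)
      have h0 : 0 ≤ v := hlog.trans hv.1
      nlinarith
    linarith
  · rw [Set.indicator_of_notMem hv]
    exact (Real.exp_pos _).le

end Kernel

/-! ### Functions with large derivatives at the vertex of the sector -/

theorem exists_le_angleCos {s α : ℝ} (hα : 0 < α) (hs : α < 1 + s) :
    ∃ c > 0, ∀ w ∈ sector α, c ≤ angleCos s w := by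
  have h1s : 0 < 1 + s := hα.trans hs
  have hκ : 0 < (1 + s)⁻¹ := inv_pos.2 h1s
  set y := (1 + s)⁻¹ * (α * Real.pi / 2) with hy
  have hy0 : 0 < y := by have := Real.pi_pos; positivity
  have hy1 : y < Real.pi / 2 := by
    have h : (1 + s)⁻¹ * α < 1 := by rwa [inv_mul_lt_iff₀ h1s, mul_one]
    have := mul_lt_mul_of_pos_right h (by have := Real.pi_pos; positivity : 0 < Real.pi / 2)
    calc y = (1 + s)⁻¹ * α * (Real.pi / 2) := by rw [hy]; ring
      _ < _ := by linarith
  refine ⟨Real.cos y, Real.cos_pos_of_mem_Ioo ⟨by linarith, hy1⟩, fun w hw => ?_⟩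
  have hw' : |w.im| < α * Real.pi / 2 := hw
  rw [angleCos, ← Real.cos_abs ((1 + s)⁻¹ * w.im), abs_mul, abs_of_pos hκ]
  refine Real.cos_le_cos_of_nonneg_of_le_pi (by positivity) (by linarith) ?_
  exact mul_le_mul_of_nonneg_left hw'.le hκ.le

theorem ofReal_mem_sector {α : ℝ} (hα : 0 < α) (x : ℝ) : (x : ℂ) ∈ sector α := by
  change |((x : ℂ)).im| < α * Real.pi / 2
  have := Real.pi_pos
  rw [Complex.ofReal_im, abs_zero]; positivity

theorem add_ofReal_mem_sector {α : ℝ} {w : ℂ} (hw : w ∈ sector α) (x : ℝ) :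
    w + (x : ℂ) ∈ sector α := by
  change |(w + (x : ℂ)).im| < α * Real.pi / 2
  rw [Complex.add_im, Complex.ofReal_im, add_zero]; exact hw

/-- A sequence of functions, each of which is minus the derivative of the one before, consists of
the derivatives of the first one up to sign. -/
theorem iterate_surfaceDeriv_eq {S : Set LogSurface} (hS : IsOpen S) {F : ℕ → LogSurface → ℂ}
    (h : ∀ j, ∀ z ∈ S, surfaceDeriv (F j) z = -F (j + 1) z) (j : ℕ) :
    ∀ z ∈ S, surfaceDeriv^[j] (F 0) z = (-1) ^ j * F j z := by
  induction j with
  | zero => intro z _; simp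
  | succ j ih =>
    intro z hz
    have he : surfaceDeriv^[j] (F 0) =ᶠ[𝓝 z] fun z => (-1) ^ j * F j z :=
      eventually_of_mem (hS.mem_nhds hz) ih
    rw [Function.iterate_succ_apply', surfaceDeriv, he.deriv_eq, deriv_const_mul_field]
    have := h j z hz
    rw [surfaceDeriv] at this
    rw [pow_succ]
    linear_combination (-1) ^ j * this

/-- The coefficients `c k` in the series `∑ c k * e (quot L k * z)`. They are such that
`c k * quot L k ^ j ≤ 2⁻¹ ^ k * L j`, with equality for `j = k`. -/
noncomputable def charCoeff (L : ℕ → ℝ) (k : ℕ) : ℝ := 2⁻¹ ^ k * (L k / quot L k ^ k)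

/-- Up to the sign `(-1) ^ j`, the `j`-th derivative of the series
`∑ c k * e (quot L k * z)` with `e = kerInt s 1`. -/
noncomputable def charFun (s : ℝ) (L : ℕ → ℝ) (j : ℕ) (w : ℂ) : ℂ :=
  ∑' k, ((charCoeff L k * quot L k ^ j : ℝ) : ℂ) *
    kerInt s (j * s + 1) (w + (Real.log (quot L k) : ℝ))

theorem summable_geometric_half_mul (x : ℝ) : Summable fun k : ℕ => (2⁻¹ : ℝ) ^ k * x :=
  (summable_geometric_of_lt_one (by norm_num) (by norm_num)).mul_right x

section CharFun

variable {L : ℕ → ℝ} (hL : IsLogConvex L)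

include hL

theorem IsLogConvex.charCoeff_pos (k : ℕ) : 0 < charCoeff L k := by
  have := hL.1 k; have := hL.quot_pos k; unfold charCoeff; positivity

theorem IsLogConvex.charCoeff_mul_le (k j : ℕ) :
    charCoeff L k * quot L k ^ j ≤ 2⁻¹ ^ k * L j := by
  have hq := hL.quot_pos k
  rw [charCoeff, mul_assoc, div_mul_eq_mul_div]
  refine mul_le_mul_of_nonneg_left ?_ (by positivity)
  rw [div_le_iff₀ (by positivity)]
  exact hL.mul_quot_pow_le k j

theorem IsLogConvex.charCoeff_mul_self (k : ℕ) :
    charCoeff L k * quot L k ^ k = 2⁻¹ ^ k * L k := by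
  have hq := hL.quot_pos k
  rw [charCoeff, mul_assoc, div_mul_cancel₀ _ (by positivity)]

variable {s α : ℝ} (hs : 0 < s) (hα : 0 < α) (hsα : α < 1 + s)

include hs hα hsα

theorem IsLogConvex.exists_charFun_bound :
    ∃ D : ℝ, 1 ≤ D ∧ ∀ (j k : ℕ), ∀ w ∈ sector α,
      ‖((charCoeff L k * quot L k ^ j : ℝ) : ℂ) *
        kerInt s (j * s + 1) (w + (Real.log (quot L k) : ℝ))‖ ≤
      2⁻¹ ^ k * (D ^ (j + 1) * (gevreyBar s j * L j)) := by
  obtain ⟨c, hc, hcS⟩ := exists_le_angleCos hα hsα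
  obtain ⟨D, hD, h⟩ := exists_norm_kerInt_le hs hc
  refine ⟨D, hD, fun j k w hw => ?_⟩
  have h1 := h j _ (hcS _ (add_ofReal_mem_sector hw (Real.log (quot L k))))
  have h2 := hL.charCoeff_mul_le k j
  have h3 : 0 < charCoeff L k * quot L k ^ j :=
    mul_pos (hL.charCoeff_pos k) (pow_pos (hL.quot_pos k) j)
  rw [norm_mul, Complex.norm_real, Real.norm_of_nonneg h3.le]
  calc _ ≤ (2⁻¹ ^ k * L j) * (D ^ (j + 1) * gevreyBar s j) :=
        mul_le_mul h2 h1 (norm_nonneg _) (h3.le.trans h2)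
    _ = _ := by ring

theorem IsLogConvex.hasDerivAt_term (j k : ℕ) {w : ℂ} (hw : w ∈ sector α) :
    HasDerivAt (fun w => ((charCoeff L k * quot L k ^ j : ℝ) : ℂ) *
        kerInt s (j * s + 1) (w + (Real.log (quot L k) : ℝ)))
      (-Complex.exp w * (((charCoeff L k * quot L k ^ (j + 1) : ℝ) : ℂ) *
        kerInt s ((j + 1 : ℕ) * s + 1) (w + (Real.log (quot L k) : ℝ)))) w := by
  obtain ⟨c, hc, hcS⟩ := exists_le_angleCos hα hsα
  have hq := hL.quot_pos k
  have h1 := hasDerivAt_kerInt hs (b := j * s + 1) (by positivity)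
    (hc.trans_le (hcS _ (add_ofReal_mem_sector hw (Real.log (quot L k)))))
  have h2 := (h1.comp_add_const w ((Real.log (quot L k) : ℝ) : ℂ)).const_mul
    ((charCoeff L k * quot L k ^ j : ℝ) : ℂ)
  refine h2.congr_deriv ?_
  have e : (j : ℝ) * s + 1 + s = ((j + 1 : ℕ) : ℝ) * s + 1 := by push_cast; ring
  rw [e, Complex.exp_add, ← Complex.ofReal_exp, Real.exp_log hq]
  push_cast
  ring

theorem IsLogConvex.differentiableOn_charFun (j : ℕ) :
    DifferentiableOn ℂ (charFun s L j) (sector α) := by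
  obtain ⟨D, -, hb⟩ := hL.exists_charFun_bound hs hα hsα
  exact Complex.differentiableOn_tsum_of_summable_norm
    (summable_geometric_half_mul (D ^ (j + 1) * (gevreyBar s j * L j)))
    (fun k w hw => (hL.hasDerivAt_term hs hα hsα j k hw).differentiableAt.differentiableWithinAt)
    (isOpen_sector α) (hb j)

theorem IsLogConvex.surfaceDeriv_charFun (j : ℕ) {w : ℂ} (hw : w ∈ sector α) :
    surfaceDeriv (charFun s L j) w = -charFun s L (j + 1) w := by
  obtain ⟨D, -, hb⟩ := hL.exists_charFun_bound hs hα hsα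
  have h := (Complex.hasSum_deriv_of_summable_norm
    (summable_geometric_half_mul (D ^ (j + 1) * (gevreyBar s j * L j)))
    (fun k w hw => (hL.hasDerivAt_term hs hα hsα j k hw).differentiableAt.differentiableWithinAt)
    (isOpen_sector α) (hb j) hw).tsum_eq
  have h2 : deriv (charFun s L j) w = -Complex.exp w * charFun s L (j + 1) w := by
    rw [charFun, ← tsum_mul_left]
    refine h.symm.trans (tsum_congr fun k => ?_)
    exact (hL.hasDerivAt_term hs hα hsα j k hw).deriv
  rw [surfaceDeriv, h2, ← mul_assoc, mul_neg, ← Complex.exp_add]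
  simp

theorem IsLogConvex.exists_norm_charFun_le :
    ∃ D : ℝ, 1 ≤ D ∧ ∀ j : ℕ, ∀ w ∈ sector α,
      ‖charFun s L j w‖ ≤ D ^ (j + 1) * (gevreyBar s j * L j) := by
  obtain ⟨D, hD, hb⟩ := hL.exists_charFun_bound hs hα hsα
  refine ⟨2 * D, by linarith, fun j w hw => ?_⟩
  have hx : 0 ≤ D ^ (j + 1) * (gevreyBar s j * L j) :=
    mul_nonneg (by positivity) (mul_pos (gevreyBar_pos s j) (hL.1 j)).le
  have hsum := (hasSum_geometric_of_lt_one (r := (2⁻¹ : ℝ)) (by norm_num) (by norm_num)).mul_right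
    (D ^ (j + 1) * (gevreyBar s j * L j))
  refine (tsum_of_norm_bounded hsum fun k => hb j k w hw).trans ?_
  have : (2 : ℝ) ≤ 2 ^ (j + 1) := by
    rw [pow_succ]; nlinarith [one_le_pow₀ (one_le_two : (1 : ℝ) ≤ 2) (n := j)]
  calc _ = 2 * (D ^ (j + 1) * (gevreyBar s j * L j)) := by norm_num
    _ ≤ 2 ^ (j + 1) * (D ^ (j + 1) * (gevreyBar s j * L j)) := by gcongr
    _ = _ := by rw [mul_pow]; ring

/-- All terms of the series are nonnegative on the positive real axis, and the term of index `j`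
alone yields the lower bound. -/
theorem IsLogConvex.charFun_ofReal (j : ℕ) (x : ℝ) : ∃ r : ℝ, 0 ≤ r ∧ charFun s L j x = r ∧
    (1 ≤ j → x + Real.log (quot L j) ≤ -(s * (Real.log j + 1)) →
      2⁻¹ ^ j * L j * (Real.exp (-1 - Real.exp 1 * j) * gevreyBar s j) ≤ r) := by
  have e : ∀ k, ((charCoeff L k * quot L k ^ j : ℝ) : ℂ) *
      kerInt s (j * s + 1) ((x : ℂ) + (Real.log (quot L k) : ℝ)) =
      ((charCoeff L k * quot L k ^ j * kerIntReal s (j * s + 1) (x + Real.log (quot L k)) : ℝ) : ℂ) :=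
    fun k => by rw [← Complex.ofReal_add, kerInt_ofReal hs]; push_cast; rfl
  have hnn : ∀ k, 0 ≤ charCoeff L k * quot L k ^ j *
      kerIntReal s (j * s + 1) (x + Real.log (quot L k)) := fun k =>
    mul_nonneg (mul_pos (hL.charCoeff_pos k) (pow_pos (hL.quot_pos k) j)).le
      (kerIntReal_nonneg _ _ _)
  refine ⟨∑' k, charCoeff L k * quot L k ^ j *
    kerIntReal s (j * s + 1) (x + Real.log (quot L k)), tsum_nonneg hnn, ?_, fun hj hx => ?_⟩
  · rw [charFun, Complex.ofReal_tsum]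
    exact tsum_congr e
  · obtain ⟨D, -, hb⟩ := hL.exists_charFun_bound hs hα hsα
    have hsum : Summable fun k => charCoeff L k * quot L k ^ j *
        kerIntReal s (j * s + 1) (x + Real.log (quot L k)) := by
      refine Summable.of_nonneg_of_le hnn (fun k => ?_)
        (summable_geometric_half_mul (D ^ (j + 1) * (gevreyBar s j * L j)))
      have := hb j k x (ofReal_mem_sector hα x)
      rwa [e, Complex.norm_real, Real.norm_of_nonneg (hnn k)] at this
    refine le_trans ?_ (hsum.le_tsum j fun k _ => hnn k)
    rw [hL.charCoeff_mul_self]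
    have := hL.1 j
    gcongr
    exact gevreyBar_le_kerIntReal hs hj hx

end CharFun

/-- If `N` is equivalent to `gevreyBar s * L` with `L` log-convex, the class of `N` on a sector of
opening `α < 1 + s` contains a function `f` for which `(-1) ^ j * f^(j) ≥ 0` on the positive real
axis, and `|f^(j)|` is, up to geometric factors, at least `N j` near the vertex. -/
theorem IsGevreyLogConvex.exists_characteristic {s α : ℝ} (hs : 0 < s) (hα : 0 < α)
    (hsα : α < 1 + s) {N : ℕ → ℝ} (hN : ∀ j, 0 < N j) (h : IsGevreyLogConvex s N) :
    ∃ f : LogSurface → ℂ, MemSeqClass N (sector α) f ∧ ∃ r : ℝ → ℕ → ℝ,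
      (∀ x j, 0 ≤ r x j ∧ surfaceDeriv^[j] f (x : ℂ) = (-1) ^ j * r x j) ∧
      ∃ D : ℝ, 1 ≤ D ∧ ∀ j, 1 ≤ j → ∀ᶠ x in atBot, N j ≤ D ^ j * r x j := by
  obtain ⟨L, hL, h1, h2⟩ := h
  have hGL : ∀ j, 0 < gevreyBar s j * L j := fun j => mul_pos (gevreyBar_pos s j) (hL.1 j)
  obtain ⟨D₁, hD₁, h1⟩ := h1.exists_one_le (fun j => (hGL j).le)
  obtain ⟨D₂, hD₂, h2⟩ := h2.exists_one_le (fun j => (hN j).le)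
  obtain ⟨D, hD, hb⟩ := hL.exists_norm_charFun_le hs hα hsα
  have hd := iterate_surfaceDeriv_eq (isOpen_sector α) (F := charFun s L)
    (fun j z hz => hL.surfaceDeriv_charFun hs hα hsα j hz)
  choose r hr using fun (x : ℝ) (j : ℕ) => hL.charFun_ofReal hs hα hsα j x
  refine ⟨charFun s L 0, memSeqClass_of_bound (hL.differentiableOn_charFun hs hα hsα 0)
    (D := D * D₂) (by positivity) fun z hz j => ?_, r, fun x j => ⟨(hr x j).1, ?_⟩, ?_⟩
  · rw [hd j z hz, norm_mul, norm_pow, norm_neg, norm_one, one_pow, one_mul]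
    calc _ ≤ D ^ (j + 1) * (gevreyBar s j * L j) := hb j z hz
      _ ≤ D ^ (j + 1) * (D₂ ^ (j + 1) * N j) := mul_le_mul_of_nonneg_left (h2 j) (by positivity)
      _ = _ := by rw [mul_pow]; ring
  · rw [hd j _ (ofReal_mem_sector hα x), (hr x j).2.1]
  · refine ⟨D₁ ^ 2 * (2 * Real.exp (1 + Real.exp 1)), ?_, fun j hj => ?_⟩
    · have h3 : (1 : ℝ) ≤ Real.exp (1 + Real.exp 1) :=
        Real.one_le_exp (by have := Real.exp_pos 1; linarith)
      nlinarith [one_le_pow₀ hD₁ (n := 2)]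
    · filter_upwards [eventually_le_atBot (-(s * (Real.log j + 1)) - Real.log (quot L j))]
        with x hx
      have h3 := (hr x j).2.2 hj (by linarith)
      have h4 : Real.exp 1 ≤ Real.exp 1 ^ j := le_self_pow₀ (Real.one_le_exp zero_le_one) (by omega)
      have h5 : Real.exp (-1 - Real.exp 1 * j) =
          (Real.exp 1)⁻¹ * ((Real.exp (Real.exp 1)) ^ j)⁻¹ := by
        rw [← Real.exp_nat_mul, ← Real.exp_neg, ← Real.exp_neg, ← Real.exp_add]
        congr 1; ring
      calc N j ≤ D₁ ^ (j + 1) * (gevreyBar s j * L j) := h1 j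
        _ ≤ (D₁ ^ 2) ^ j * (gevreyBar s j * L j) := by
            have := hGL j
            gcongr
            exact pow_succ_le_sq_pow hD₁ hj
        _ = (D₁ ^ 2) ^ j * (2 ^ j * (Real.exp 1 * (Real.exp (Real.exp 1)) ^ j) *
            (2⁻¹ ^ j * L j * (Real.exp (-1 - Real.exp 1 * j) * gevreyBar s j))) := by
            rw [h5, inv_pow]; field_simp
        _ ≤ (D₁ ^ 2) ^ j * (2 ^ j * (Real.exp 1 ^ j * (Real.exp (Real.exp 1)) ^ j) * r x j) := by
            have := (hr x j).1
            have := hL.1 j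
            have := gevreyBar_pos s j
            gcongr
        _ = _ := by rw [Real.exp_add, mul_pow, mul_pow, mul_pow]; ring

/-! ### Inverse-closed classes -/

/-- The Taylor coefficients of `1 / (λ - F)`, when those of `F` have alternating signs: they have
alternating signs too, and satisfy the inequality that comes from
`λ - F` times `1 / (λ - F)` being `1`. -/
theorem exists_coeff_inv_sub {F : ℂ → ℂ} {ζ : ℂ} (hF : AnalyticAt ℂ F ζ) {a : ℕ → ℝ}
    (ha : ∀ i, 0 ≤ a i) (hFa : ∀ i, iteratedDeriv i F ζ = (-1) ^ i * i.factorial * a i)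
    {μ : ℝ} (hμ : a 0 < μ) :
    ∃ b : ℕ → ℝ, b 0 = (μ - a 0)⁻¹ ∧ (∀ k, 0 ≤ b k) ∧
      (∀ k, iteratedDeriv k (fun z => 1 / ((μ : ℂ) - F z)) ζ = (-1) ^ k * k.factorial * b k) ∧
      ∀ i m, 1 ≤ i → a i * b m ≤ μ * b (i + m) := by
  set Φ : ℂ → ℂ := fun z => 1 / ((μ : ℂ) - F z) with hΦ
  have hδ : 0 < μ - a 0 := sub_pos.2 hμ
  have hF0 : F ζ = a 0 := by simpa using hFa 0
  have hne : (μ : ℂ) - F ζ ≠ 0 := by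
    rw [hF0]; exact_mod_cast hδ.ne'
  have hG : AnalyticAt ℂ (fun z => (μ : ℂ) - F z) ζ := analyticAt_const.sub hF
  have hΦa : AnalyticAt ℂ Φ ζ := analyticAt_const.div hG hne
  have hprod : (fun z => ((μ : ℂ) - F z) * Φ z) =ᶠ[𝓝 ζ] fun _ => 1 := by
    filter_upwards [hG.continuousAt.eventually_ne hne] with z hz
    exact mul_one_div_cancel hz
  have hGi : ∀ i, iteratedDeriv (i + 1) (fun z => (μ : ℂ) - F z) ζ =
      -iteratedDeriv (i + 1) F ζ := fun i => by
    rw [iteratedDeriv_const_sub (Nat.succ_pos i)]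
    exact iteratedDeriv_fun_neg _ _ _
  have hrec : ∀ k, 1 ≤ k → ((μ - a 0 : ℝ) : ℂ) * iteratedDeriv k Φ ζ =
      ∑ i ∈ Finset.range k, k.choose (i + 1) * iteratedDeriv (i + 1) F ζ *
        iteratedDeriv (k - (i + 1)) Φ ζ := by
    intro k hk
    have h1 := hprod.iteratedDeriv_eq k
    rw [iteratedDeriv_const, if_neg (by omega), iteratedDeriv_fun_mul hG.contDiffAt hΦa.contDiffAt,
      Finset.sum_range_succ'] at h1
    simp only [hGi, Nat.choose_zero_right, iteratedDeriv_zero, hF0, Nat.sub_zero] at h1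
    have h2 : ∑ i ∈ Finset.range k, (k.choose (i + 1) : ℂ) * -iteratedDeriv (i + 1) F ζ *
        iteratedDeriv (k - (i + 1)) Φ ζ = -∑ i ∈ Finset.range k, k.choose (i + 1) *
          iteratedDeriv (i + 1) F ζ * iteratedDeriv (k - (i + 1)) Φ ζ := by
      rw [← Finset.sum_neg_distrib]
      exact Finset.sum_congr rfl fun i _ => by ring
    rw [h2] at h1
    push_cast at h1 ⊢
    linear_combination h1
  -- the Leibniz rule in terms of coefficients: the signs `(-1) ^ k` factor out
  have hterm : ∀ (b : ℕ → ℝ) (k : ℕ), (∀ m < k, iteratedDeriv m Φ ζ =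
      (-1) ^ m * m.factorial * b m) → 1 ≤ k → ((μ - a 0 : ℝ) : ℂ) * iteratedDeriv k Φ ζ =
      (-1) ^ k * k.factorial *
        ((∑ i ∈ Finset.range k, a (i + 1) * b (k - (i + 1)) : ℝ) : ℂ) := by
    intro b k hb hk
    rw [hrec k hk]
    push_cast
    rw [Finset.mul_sum]
    refine Finset.sum_congr rfl fun i hi => ?_
    have hik : i + 1 ≤ k := Finset.mem_range.1 hi
    rw [hFa, hb _ (by omega)]
    have h1 : ((k.choose (i + 1) : ℂ)) * (i + 1).factorial * (k - (i + 1)).factorial =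
        k.factorial := by exact_mod_cast Nat.choose_mul_factorial_mul_factorial hik
    have h2 : (-1 : ℂ) ^ (i + 1) * (-1) ^ (k - (i + 1)) = (-1) ^ k := by
      rw [← pow_add, Nat.add_sub_cancel' hik]
    rw [← h1, ← h2]
    ring
  have hex : ∀ k, ∃ b : ℝ, 0 ≤ b ∧ iteratedDeriv k Φ ζ = (-1) ^ k * k.factorial * b := by
    intro k
    induction k using Nat.strong_induction_on with
    | _ k ih =>
      rcases Nat.eq_zero_or_pos k with rfl | hk
      · refine ⟨(μ - a 0)⁻¹, (inv_pos.2 hδ).le, ?_⟩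
        simp only [iteratedDeriv_zero, hΦ, hF0]
        push_cast
        simp
      · choose! b hb0 hb using ih
        have h1 := hterm b k hb hk
        refine ⟨(μ - a 0)⁻¹ * ∑ i ∈ Finset.range k, a (i + 1) * b (k - (i + 1)),
          mul_nonneg (inv_pos.2 hδ).le (Finset.sum_nonneg fun i hi =>
            mul_nonneg (ha _) (hb0 _ (by have := Finset.mem_range.1 hi; omega))), ?_⟩
        have hδ' : ((μ - a 0 : ℝ) : ℂ) ≠ 0 := by exact_mod_cast hδ.ne'
        rw [Complex.ofReal_mul, Complex.ofReal_inv]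
        refine mul_left_cancel₀ hδ' (h1.trans ?_)
        field_simp
  choose b hb0 hb using hex
  refine ⟨b, ?_, hb0, hb, fun i m hi => ?_⟩
  · have h1 := hb 0
    simp only [iteratedDeriv_zero, hΦ, hF0, pow_zero, Nat.factorial_zero, Nat.cast_one,
      one_mul, one_div] at h1
    exact_mod_cast h1.symm
  · have hk : 1 ≤ i + m := by omega
    have h1 := hterm b (i + m) (fun m _ => hb m) hk
    have hc : ((-1 : ℂ) ^ (i + m) * (i + m).factorial) ≠ 0 :=
      mul_ne_zero (pow_ne_zero _ (by norm_num)) (by exact_mod_cast Nat.factorial_ne_zero _)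
    have h2 : ((μ - a 0 : ℝ) : ℂ) * b (i + m) =
        ((∑ l ∈ Finset.range (i + m), a (l + 1) * b (i + m - (l + 1)) : ℝ) : ℂ) := by
      rw [hb] at h1
      exact mul_left_cancel₀ hc (by linear_combination h1)
    have h3 : (μ - a 0) * b (i + m) =
        ∑ l ∈ Finset.range (i + m), a (l + 1) * b (i + m - (l + 1)) := by exact_mod_cast h2
    have h4 := Finset.single_le_sum (f := fun l => a (l + 1) * b (i + m - (l + 1)))
      (s := Finset.range (i + m)) (fun l _ => mul_nonneg (ha _) (hb0 _))
      (Finset.mem_range.2 (show i - 1 < i + m by omega))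
    simp only [Nat.sub_add_cancel hi, Nat.add_sub_cancel_left] at h4
    have h5 := mul_nonneg (ha 0) (hb0 (i + m))
    linarith

theorem list_prod_mul_le {u b : ℕ → ℝ} (hu : ∀ i, 0 ≤ u i) {K : ℝ} (hK : 0 ≤ K) (l : List ℕ)
    (h : ∀ i ∈ l, ∀ m, u i * b m ≤ K ^ i * b (i + m)) :
    (l.map u).prod * b 0 ≤ K ^ l.sum * b l.sum := by
  induction l with
  | nil => simp
  | cons i l ih =>
    have ih := ih fun i hi => h i (List.mem_cons_of_mem _ hi)
    rw [List.map_cons, List.prod_cons, List.sum_cons]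
    calc u i * (l.map u).prod * b 0 = u i * ((l.map u).prod * b 0) := by ring
      _ ≤ u i * (K ^ l.sum * b l.sum) := mul_le_mul_of_nonneg_left ih (hu i)
      _ = K ^ l.sum * (u i * b l.sum) := by ring
      _ ≤ K ^ l.sum * (K ^ i * b (i + l.sum)) :=
          mul_le_mul_of_nonneg_left (h i List.mem_cons_self _) (by positivity)
      _ = _ := by ring

theorem surfaceDeriv_neg (f : LogSurface → ℂ) :
    surfaceDeriv (fun z => -f z) = fun z => -surfaceDeriv f z := by
  funext z
  rw [surfaceDeriv, surfaceDeriv, deriv.fun_neg, mul_neg]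

theorem iterate_surfaceDeriv_neg (f : LogSurface → ℂ) (j : ℕ) :
    surfaceDeriv^[j] (fun z => -f z) = fun z => -surfaceDeriv^[j] f z := by
  induction j with
  | zero => rfl
  | succ j ih => rw [Function.iterate_succ_apply', ih, surfaceDeriv_neg, Function.iterate_succ_apply']

theorem MemSeqClass.const_sub {N : ℕ → ℝ} (hN : ∀ j, 0 < N j) {S : Set LogSurface}
    {f : LogSurface → ℂ} (hf : MemSeqClass N S f) (c : ℂ) :
    MemSeqClass N S (fun z => c - f z) := by
  obtain ⟨D, hD, h⟩ := hf.exists_bound hN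
  have hN0 := hN 0
  refine ⟨(differentiableOn_const c).sub hf.1, D, by positivity, D + ‖c‖ / N 0, fun z hz j => ?_⟩
  cases j with
  | zero =>
    have h0 := h z hz 0
    simp only [Function.iterate_zero, id_eq, zero_add, pow_one, pow_zero, one_mul] at h0 ⊢
    rw [add_mul, div_mul_cancel₀ _ hN0.ne']
    linarith [norm_sub_le c (f z)]
  | succ j =>
    have e : surfaceDeriv (fun z => c - f z) = surfaceDeriv (fun z => -f z) := by
      funext z
      rw [surfaceDeriv, surfaceDeriv, deriv_const_sub, deriv.fun_neg]
    rw [Function.iterate_succ_apply, e, ← Function.iterate_succ_apply,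
      iterate_surfaceDeriv_neg, norm_neg]
    have := hN (j + 1)
    calc _ ≤ D ^ (j + 1 + 1) * N (j + 1) := h z hz (j + 1)
      _ = D * (D ^ (j + 1) * N (j + 1)) := by ring
      _ ≤ _ := by gcongr; exact le_add_of_nonneg_right (by positivity)

/-- For a characteristic function `f` of a row of `M`, the class contains `1 / (λ - f)` for large
`λ`. The Taylor coefficients of this function dominate products of those of `f`. -/
theorem InverseClosed.condRai {M : Idx → ℕ → ℝ} (hM : IsWeightMatrix M) {s α : ℝ} (hs : 0 < s)
    (hα : 0 < α) (hsα : α < 1 + s) (h : ∀ p, IsGevreyLogConvex s (M p))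
    (hi : InverseClosed M (sector α)) : CondRai M := by
  refine hM.condRai_of_prod_le (s := fun _ => s) (fun _ => hs.le) h fun p => ⟨p, le_rfl, ?_⟩
  obtain ⟨f, hf, r, hr, D, hD, hDr⟩ := (h p).exists_characteristic hs hα hsα (hM.pos p)
  obtain ⟨C, hC, hfC⟩ := hf.exists_bound (hM.pos p)
  have hfC' : ∀ z ∈ sector α, ‖f z‖ ≤ C := fun z hz => by
    simpa [hM.zero p] using hfC z hz 0
  -- `λ = C + 1` keeps `|λ - f|` above `1`
  set μ := C + 1 with hμ
  have hμ0 : 0 < μ := by positivity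
  obtain ⟨q, hq⟩ := hi (fun z => (μ : ℂ) - f z) ⟨p, hf.const_sub (hM.pos p) μ⟩
    ⟨1, one_pos, fun z hz => by
      have h1 := norm_sub_norm_le (μ : ℂ) (f z)
      rw [Complex.norm_real, Real.norm_of_nonneg hμ0.le] at h1
      linarith [hfC' z hz]⟩
  obtain ⟨D', hD', hq'⟩ := hq.exists_bound (hM.pos q)
  refine ⟨q, μ * (D * μ) * D', ?_, fun l hl hpos => ?_⟩
  · have : 1 ≤ μ := by linarith
    exact one_le_mul_of_one_le_of_one_le (one_le_mul_of_one_le_of_one_le this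
      (one_le_mul_of_one_le_of_one_le hD this)) hD'
  obtain ⟨x, hx⟩ : ∃ x : ℝ, ∀ i ∈ l, M p i ≤ D ^ i * r x i := by
    have : ∀ᶠ x in atBot, ∀ i ∈ l.toFinset, M p i ≤ D ^ i * r x i :=
      (Filter.eventually_all_finset _).2 fun i hi => hDr i (hpos i (List.mem_toFinset.1 hi))
    obtain ⟨x, hx⟩ := this.exists
    exact ⟨x, fun i hi => hx i (List.mem_toFinset.2 hi)⟩
  have hxS : (x : ℂ) ∈ sector α := ofReal_mem_sector hα x
  have hS := isOpen_sector α
  have hF := analyticAt_comp_branch hS hf.1 hxS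
  have hr0 : r x 0 < μ := by
    have h1 := hfC' x hxS
    have h2 := (hr x 0).2
    simp only [Function.iterate_zero, id_eq, pow_zero, one_mul] at h2
    rw [h2, Complex.norm_real, Real.norm_of_nonneg (hr x 0).1] at h1
    linarith
  obtain ⟨b, hb0, hbnn, hb, hab⟩ := exists_coeff_inv_sub hF (a := fun i => r x i / i.factorial)
    (fun i => div_nonneg (hr x i).1 (by positivity))
    (fun i => by
      rw [iteratedDeriv_comp_branch hS hf.1 hxS, (hr x i).2]
      have : (i.factorial : ℂ) ≠ 0 := by exact_mod_cast Nat.factorial_ne_zero i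
      push_cast; field_simp) (μ := μ)
    (by simpa using hr0)
  have hbq : ∀ k, b k ≤ D' ^ (k + 1) * check (M q) k := fun k => by
    have h1 := hq' x hxS k
    rw [← iteratedDeriv_comp_branch hS hq.1 hxS, hb k, norm_mul, norm_mul, norm_pow, norm_neg,
      norm_one, one_pow, one_mul, Complex.norm_natCast, Complex.norm_real,
      Real.norm_of_nonneg (hbnn k)] at h1
    rw [check, mul_div_assoc', le_div_iff₀ (by positivity)]
    linarith
  have hstep : ∀ i ∈ l, ∀ m, check (M p) i * b m ≤ (D * μ) ^ i * b (i + m) := fun i hi m => by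
    have h1 := hab i m (hpos i hi)
    have h2 : check (M p) i ≤ D ^ i * (r x i / i.factorial) := by
      rw [check, mul_div_assoc']; gcongr; exact hx i hi
    have h3 : μ ≤ μ ^ i := le_self_pow₀ (by linarith) (by have := hpos i hi; omega)
    calc _ ≤ D ^ i * (r x i / i.factorial) * b m := mul_le_mul_of_nonneg_right h2 (hbnn m)
      _ = D ^ i * (r x i / i.factorial * b m) := by ring
      _ ≤ D ^ i * (μ ^ i * b (i + m)) := mul_le_mul_of_nonneg_left
          (h1.trans (mul_le_mul_of_nonneg_right h3 (hbnn _))) (by positivity)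
      _ = _ := by rw [mul_pow]; ring
  have hmain := list_prod_mul_le (fun i => (hM.check_pos p i).le) (by positivity : 0 ≤ D * μ) l hstep
  have hP : 0 ≤ (l.map (check (M p))).prod :=
    List.prod_nonneg (by
      intro y hy
      obtain ⟨i, -, rfl⟩ := List.mem_map.1 hy
      exact (hM.check_pos p i).le)
  have hb0' : 1 ≤ μ * b 0 := by
    rw [hb0]
    have h0 := (hr x 0).1
    have h1 : 0 < μ - r x 0 / (Nat.factorial 0 : ℝ) := by simpa using hr0
    rw [← div_eq_mul_inv, one_le_div h1]
    simp only [Nat.factorial_zero, Nat.cast_one, div_one]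
    linarith
  have hμ1 : 1 ≤ μ := by linarith
  calc (l.map (check (M p))).prod ≤ (l.map (check (M p))).prod * (μ * b 0) :=
        le_mul_of_one_le_right hP hb0'
    _ = μ * ((l.map (check (M p))).prod * b 0) := by ring
    _ ≤ μ ^ (l.sum + 1) * ((D * μ) ^ (l.sum + 1) *
        (D' ^ (l.sum + 1) * check (M q) l.sum)) := by
        have h1 : 0 ≤ b l.sum := hbnn _
        have h2 : 1 ≤ D * μ := one_le_mul_of_one_le_of_one_le hD hμ1
        have h3 : (D * μ) ^ l.sum ≤ (D * μ) ^ (l.sum + 1) := pow_le_pow_right₀ h2 (Nat.le_succ _)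
        have h4 : μ ≤ μ ^ (l.sum + 1) := le_self_pow₀ hμ1 (by omega)
        have h5 : (l.map (check (M p))).prod * b 0 ≤ (D * μ) ^ (l.sum + 1) *
            (D' ^ (l.sum + 1) * check (M q) l.sum) :=
          hmain.trans (mul_le_mul h3 (hbq _) h1 (by positivity))
        exact mul_le_mul h4 h5 (mul_nonneg hP (hbnn 0)) (by positivity)
    _ = _ := by rw [mul_pow (μ * (D * μ)), mul_pow μ (D * μ)]; ring

end Ultraholo

theorem mainTheorem12 (M : Idx → ℕ → ℝ) (hM : IsWeightMatrix M) (α : ℝ) (hα : 1 < α)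
    (a : Idx → ℝ) (ha : ∀ p, α < a p)
    (hlc : ∀ p, ∃ L : ℕ → ℝ, IsLogConvex L ∧
      SeqEquiv (fun j => gevreyBar (1 - a p) j * M p j) L)
    (β : ℝ) (hαβ : α < β) (hβ : ∀ p, β < a p) :
    -- the condition under which the matrix `rami M β` is defined
    (∀ p, Filter.Tendsto (fun j : ℕ => (gevreyBar (1 - β) j * M p j) ^ (1 / (j : ℝ)))
      Filter.atTop Filter.atTop) ∧
    [CondRai M,
      CondRai (rami M β),
      HolomorphicallyClosed M (sector α),
      InverseClosed M (sector α)].TFAE ∧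
    (CondFdB M ↔ CondFdB (rami M β)) ∧
    (CondComega M → CondDc M →
      [CondRai M,
        CondRai (rami M β),
        HolomorphicallyClosed M (sector α),
        InverseClosed M (sector α),
        CompositionClosed M (sector α),
        CondFdB M,
        CondFdB (rami M β)].TFAE) := by
  have hS := isOpen_sector α
  have hrow : ∀ p, IsGevreyLogConvex (β - 1) (M p) := fun p => by
    obtain ⟨L, hL, h⟩ := hlc p
    refine (isGevreyLogConvex_of_seqEquiv (s := a p - 1) hL ?_).of_le (by linarith [hβ p])
    rwa [neg_sub]
  have hrami := fun p => rami_spec (hrow p)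
  have hequiv : ∀ p, SeqEquiv (M p) (rami M β p) := fun p => (hrami p).2.symm
  have rai_iff : CondRai M ↔ CondRai (rami M β) :=
    ⟨CondRai.of_seqEquiv hM.pos (fun p => (hrami p).1) hequiv,
      CondRai.of_seqEquiv (fun p => (hrami p).1) hM.pos fun p => (hrami p).2⟩
  have fdb_iff : CondFdB M ↔ CondFdB (rami M β) :=
    ⟨CondFdB.of_seqEquiv hM.pos (fun p => (hrami p).1) hequiv,
      CondFdB.of_seqEquiv (fun p => (hrami p).1) hM.pos fun p => (hrami p).2⟩
  have rai_hol : CondRai M → HolomorphicallyClosed M (sector α) :=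
    CondRai.holomorphicallyClosed hM hS
  have hol_inv : HolomorphicallyClosed M (sector α) → InverseClosed M (sector α) :=
    HolomorphicallyClosed.inverseClosed
  have inv_rai : InverseClosed M (sector α) → CondRai M :=
    InverseClosed.condRai hM (s := β - 1) (by linarith) (by linarith) (by linarith) hrow
  refine ⟨fun p => ?_, ?_, fdb_iff, fun hc hd => ?_⟩
  · obtain ⟨L, hL, h⟩ := isGevreyLogConvex_of_seqEquiv (s := a p - 1) (hlc p).choose_spec.1 (by
      rw [neg_sub]; exact (hlc p).choose_spec.2)
    have e : (fun j => gevreyBar (1 - β) j * (gevreyBar (a p - 1) j * L j)) =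
        fun j => gevreyBar (a p - β) j * L j := by
      funext j
      rw [← mul_assoc, gevreyBar_mul]
      congr 2; ring
    have h1 := h.1.mul_left (fun j => (gevreyBar_pos (1 - β) j).le)
    have h2 := h.2.mul_left (fun j => (gevreyBar_pos (1 - β) j).le)
    rw [e] at h1 h2
    exact IsGevreyLogConvex.tendsto_root (s := a p - β) (by linarith [hβ p])
      (fun j => mul_pos (gevreyBar_pos _ _) (hM.pos p j)) ⟨L, hL, h1, h2⟩
  · tfae_have 1 ↔ 2 := rai_iff
    tfae_have 1 → 3 := rai_hol
    tfae_have 3 → 4 := hol_inv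
    tfae_have 4 → 1 := inv_rai
    tfae_finish
  · tfae_have 1 ↔ 2 := rai_iff
    tfae_have 1 → 3 := rai_hol
    tfae_have 3 → 4 := hol_inv
    tfae_have 4 → 1 := inv_rai
    tfae_have 6 ↔ 7 := fdb_iff
    tfae_have 1 → 6 := fun h => h.condFdB hM hd
    tfae_have 6 → 5 := CondFdB.compositionClosed hM hS
    tfae_have 5 → 3 := fun h => h.holomorphicallyClosed hM hc
    tfae_finish
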